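/- Let $H$ be an $\mathbb R^d$-valued random vector such that $nP(a_n^{-1}H\in\cdot)\to\mu$ vaguely on $\overline{\mathbb R^d}\setminus\{0\}$ for some sequence $a_n\to\infty$ and some non-null Radon measure $\mu$ on $\overline{\mathbb R^d}\setminus\{0\}$ with $\mu(\overline{\mathbb R^d}\setminus\mathbb R^d)=0$, where $\overline{\mathbb R^d}$ is the compactification of $\mathbb R^d$ by a sphere at infinity. Let $\alpha>0$ be its tail index, i.e. $\mu(cA)=c^{-\alpha}\mu(A)$ for all $c>0$ and all Borel $A\subset\mathbb R^d\setminus\{0\}$, and suppose $\alpha<2$. If $\alpha=1$, assume that $H$ and $-H$ have the same law; if $1<\alpha<2$, assume that $EH=0$. Let $L\ge0$ be a random variable with $Ee^{\varepsilon L}<\infty$ for some $\varepsilon>0$. Let $H_1,H_2,\dots$ be i.i.d. copies of $H$ and $L_1,L_2,\dots$ i.i.d. copies of $L$, the two sequences being independent of each other. Let $M_n\to\infty$ be such that $nP(\|H\|>M_n)\to\infty$ (hard truncation), where $\|\cdot\|$ is the Euclidean norm, and put $$X_{nj}=H_j\mathbf 1(\|H_j\|\le M_n)+\frac{H_j}{\|H_j\|}(M_n+L_j)\mathbf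 1(\|H_j\|>M_n),\qquad S_n=\sum_{j=1}^nX_{nj}.$$ Let $B_1=\{x:\|x\|\le1\}$, $\mathcal S=\{x:\|x\|=1\}$, and for Borel sets $A$ let $$\sigma(A)=\frac{\mu\{x\in\mathbb R^d:\|x\|\ge1,\ x/\|x\|\in A\}}{\mu(B_1^c)},\qquad \nu(A)=\frac{\mu(A\cap B_1)}{\mu(B_1^c)}+\sigma(A\cap\mathcal S).$$ For $\lambda\in\mathbb R^d$ let $$\Lambda(\lambda)=\begin{cases}\int_{\mathbb R^d}(e^{\langle\lambda,x\rangle}-1)\,\nu(dx),&0<\alpha<1,\\ \int_{\mathbb R^d}(e^{\langle\lambda,x\rangle}-1-\langle\lambda,x\rangle)\,\nu(dx),&\alpha=1,\\ \int_{\mathbb R^d}(e^{\langle\lambda,x\rangle}-1-\langle\lambda,x\rangle)\,\nu(dx)-\frac1{\alpha-1}\int_{\mathcal S}\langle\lambda,s\rangle\,\sigma(ds),&1<\alpha<2.\end{cases}$$ Then these integrals converge absolutely, and $Z_n=S_n/\{nM_nP(\|H\|>M_n)\}$ satisfies the large deviation principle with speed $c_n=nP(\|H\|>M_n)$ and rate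 function the Fenchel–Legendre transform $\Lambda^*(x)=\sup_{\lambda\in\mathbb R^d}(\langle\lambda,x\rangle-\Lambda(\lambda))$. That is, $\Lambda^*$ is lower semicontinuous with values in $[0,\infty]$, and for every Borel set $A\subset\mathbb R^d$, $$-\inf_{x\in\operatorname{int}A}\Lambda^*(x)\le\liminf_{n\to\infty}\frac1{c_n}\log P(Z_n\in A)\le\limsup_{n\to\infty}\frac1{c_n}\log P(Z_n\in A)\le-\inf_{x\in\operatorname{cl}A}\Lambda^*(x).$$ -/

import Mathlib

open MeasureTheory ProbabilityTheory Filter Topology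

noncomputable section

namespace TruncatedTails

/-- The Euclidean space `ℝ^d` with the `L²` norm. -/
abbrev E (d : ℕ) : Type := EuclideanSpace ℝ (Fin d)

/-! ### Vague convergence on the punctured compactification of `ℝ^d` -/

/-- The compactification of `ℝ^d` by a sphere at infinity, with the origin removed. It is modelled
by the closed unit ball without `0`: a point `x` of `ℝ^d` is represented by `x / (1 + ‖x‖)`, and
the unit sphere represents the points at infinity. -/
abbrev PuncturedExt (d : ℕ) : Type := {y : E d // ‖y‖ ≤ 1 ∧ y ≠ 0}

/-- The inclusion of `ℝ^d` in its compactification. -/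
def radial {d : ℕ} (x : E d) : E d := (1 + ‖x‖)⁻¹ • x

/-- A measure on `ℝ^d`, restricted to `ℝ^d ∖ {0}` and extended to the punctured compactification
by giving no mass to the points at infinity. -/
def extend {d : ℕ} (m : Measure (E d)) : Measure (PuncturedExt d) :=
  (m.map radial).comap Subtype.val

/-- Vague convergence: convergence of the integrals of continuous compactly supported functions. -/
def VagueTendsto {X : Type*} [TopologicalSpace X] [MeasurableSpace X]
    (ms : ℕ → Measure X) (m : Measure X) : Prop :=
  ∀ f : X → ℝ, Continuous f → HasCompactSupport f →
    Tendsto (fun n => ∫ x, f x ∂(ms n)) atTop (𝓝 (∫ x, f x ∂m))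

/-! ### Power-law tails -/

/-- `n P(H / a_n ∈ ·) → μ` vaguely on the punctured compactification of `ℝ^d`, where `a_n → ∞` and
`μ` is a non-null Radon measure without mass at infinity. A measure on `ℝ^d ∖ {0}` is regarded as a
measure on `ℝ^d` that does not charge `0`; the relatively compact subsets of the punctured
compactification are those bounded away from `0`, so that being Radon means being finite on
`{x | r < ‖x‖}` for every `r > 0`. -/
structure HasPowerLawTail {Ω : Type*} [MeasurableSpace Ω] {d : ℕ} (P : Measure Ω)
    (H : Ω → E d) (a : ℕ → ℝ) (μ : Measure (E d)) : Prop where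
  scale_tendsto : Tendsto a atTop atTop
  not_charge_zero : μ {0} = 0
  non_null : μ ≠ 0
  radon : ∀ r : ℝ, 0 < r → μ {x | r < ‖x‖} < ⊤
  vague : VagueTendsto
    (fun n => extend ((n : ENNReal) • P.map (fun ω => (a n)⁻¹ • H ω))) (extend μ)

/-- `α` is the tail index of `μ`: `μ(cA) = c^{-α} μ(A)` for all `c > 0` and all Borel sets `A`. -/
def IsTailIndex {d : ℕ} (μ : Measure (E d)) (α : ℝ) : Prop :=
  0 < α ∧ ∀ c : ℝ, 0 < c → ∀ A : Set (E d), MeasurableSet A →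
    μ ((fun x => c • x) '' A) = ENNReal.ofReal (c ^ (-α)) * μ A

/-- The spectral measure `σ(A) = μ{x : ‖x‖ ≥ 1, x/‖x‖ ∈ A} / μ(B_1ᶜ)`, as a measure on `ℝ^d`
(carried by the unit sphere), where `B_1` is the closed unit ball. -/
def spectral {d : ℕ} (μ : Measure (E d)) : Measure (E d) :=
  (μ (Metric.closedBall 0 1)ᶜ)⁻¹ • (μ.restrict {x | 1 ≤ ‖x‖}).map (fun x => ‖x‖⁻¹ • x)

/-- The measure `ν(A) = μ(A ∩ B_1) / μ(B_1ᶜ) + σ(A ∩ S)`, where `S` is the unit sphere. -/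
def nu {d : ℕ} (μ : Measure (E d)) : Measure (E d) :=
  (μ (Metric.closedBall 0 1)ᶜ)⁻¹ • μ.restrict (Metric.closedBall 0 1)
    + (spectral μ).restrict (Metric.sphere 0 1)

/-! ### The truncated model -/

/-- The truncation of `h` at level `M`:
`h 1(‖h‖ ≤ M) + (h/‖h‖) (M + l) 1(‖h‖ > M)`. -/
def truncate {d : ℕ} (M : ℝ) (h : E d) (l : ℝ) : E d :=
  if ‖h‖ ≤ M then h else (M + l) • (‖h‖⁻¹ • h)

/-- The row sum `S_n`; the copies of `H` and `L` are numbered from `0`. -/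
def rowSum {Ω : Type*} {d : ℕ} (M : ℕ → ℝ) (Hs : ℕ → Ω → E d) (Ls : ℕ → Ω → ℝ) (n : ℕ) (ω : Ω) :
    E d :=
  ∑ j ∈ Finset.range n, truncate (M n) (Hs j ω) (Ls j ω)

/-! ### Large deviations -/

/-- The large deviation principle with speed `c_n` and rate function `I`: the function `I` is
lower semicontinuous with values in `[0, ∞]`, and
`-inf_{int A} I ≤ liminf c_n⁻¹ log P(Z_n ∈ A) ≤ limsup c_n⁻¹ log P(Z_n ∈ A) ≤ -inf_{cl A} I`
for every Borel set `A`, with `log 0 = -∞` and `inf ∅ = ∞`. -/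
structure IsLDP {Ω : Type*} [MeasurableSpace Ω] {X : Type*} [TopologicalSpace X]
    [MeasurableSpace X] (P : Measure Ω) (Z : ℕ → Ω → X) (c : ℕ → ℝ) (I : X → EReal) : Prop where
  nonneg : ∀ x, 0 ≤ I x
  lsc : LowerSemicontinuous I
  lower : ∀ A : Set X, MeasurableSet A →
    -(⨅ x ∈ interior A, I x) ≤
      liminf (fun n => (((c n)⁻¹ : ℝ) : EReal) * ENNReal.log (P {ω | Z n ω ∈ A})) atTop
  upper : ∀ A : Set X, MeasurableSet A →
    limsup (fun n => (((c n)⁻¹ : ℝ) : EReal) * ENNReal.log (P {ω | Z n ω ∈ A})) atTop ≤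
      -(⨅ x ∈ closure A, I x)

/-- The Fenchel–Legendre transform `Λ*(x) = sup_l (⟨l, x⟩ - Λ(l))`. -/
def fenchelLegendre {d : ℕ} (Λ : E d → ℝ) (x : E d) : EReal :=
  ⨆ l : E d, ((inner ℝ l x - Λ l : ℝ) : EReal)

/-- The integrand of the `ν`-integral in `Λ`: `e^{⟨l,x⟩} - 1` for `α < 1`, and
`e^{⟨l,x⟩} - 1 - ⟨l,x⟩` for `α ≥ 1`. -/
def integrand {d : ℕ} (α : ℝ) (l x : E d) : ℝ :=
  if α < 1 then Real.exp (inner ℝ l x) - 1 else Real.exp (inner ℝ l x) - 1 - inner ℝ l x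

/-- The function `Λ`, for `0 < α < 2`. -/
def Lam {d : ℕ} (μ : Measure (E d)) (α : ℝ) (l : E d) : ℝ :=
  if α ≤ 1 then ∫ x, integrand α l x ∂(nu μ)
  else (∫ x, integrand α l x ∂(nu μ)) - 1 / (α - 1) * ∫ s, inner ℝ l s ∂(spectral μ)

end TruncatedTails

end

/-! By the Gärtner–Ellis theorem it is enough that c_n⁻¹ log E exp(c_n⟨l, Z_n⟩) converges to a limit
that is finite and differentiable everywhere. Since c_n Z_n = S_n / M_n, independence reduces this
to one summand. With G(t) = P(‖H‖ > t) and W_n = E exp⟨l, X_{n1}/M_n⟩, the quantity is log W_n /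
G(M_n), and since G(M_n) → 0 the task is to show (W_n - 1)/G(M_n) → Λ(l); this is
`HasPowerLawTail.tendsto_integral_exp_truncate`.

At level t the exponential minus one splits into four terms (`exp_inner_truncate`): a compensated
exponential of H/t on the unit ball, the linear compensator, e^{⟨l,θ⟩} - 1 in the direction θ of H
outside the ball, and an overshoot due to L. Everything but the overshoot rests on tail integrals of
functions of the direction, which vary regularly with index -α
(`HasPowerLawTail.tendsto_tailIntegral`).

On the ball, Fubini converts the integral into one over levels s in (0, 1] of differences of tail
integrals (`integral_ball_eq`), and a Potter bound dominates. Compensation of order b contributes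
s^b against tails of order s^{-α}, which is integrable at 0 because α < 1 + b. The compensator
vanishes for α = 1 by symmetry. For α > 1 centring turns it into minus a first moment over the tail,
with coefficient 1 + 1/(α-1): the 1 compensates the integrand on the sphere, the rest is the extra
term of Λ. The overshoot is negligible because E e^{‖l‖L/t} → 1.

In Gärtner–Ellis, the upper bound is Chernoff's on small balls, combined with compactness and
exponential tightness. For the lower bound, tilting by l concentrates the law at the gradient of Λ
at l. A point of finite rate need not be a gradient, but minimising Λ - ⟨·, y⟩ plus a small
quadratic term produces a nearby gradient of no larger rate (`exists_gradient_near`), so neither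
convexity nor steepness has to be invoked. -/

namespace TruncatedTails

/-! ### Large deviations from convergence of the scaled cumulant generating functions -/

/-- Finitely many linear functionals dominate the Euclidean norm. -/
lemma exists_norming_finset (d : ℕ) :
    ∃ V : Finset (E d), ∀ z : E d, z ≠ 0 → ∃ v ∈ V, ‖z‖ ≤ inner ℝ v z := by
  classical
  -- The vectors ±d·eᵢ serve: the Euclidean norm is at most the sum of the |zᵢ|, so some |zᵢ| is at
  -- least ‖z‖/d. In dimension zero the family is empty, whence the restriction to z ≠ 0.
  refine ⟨Finset.univ.image (fun i : Fin d => (d : ℝ) • EuclideanSpace.single i (1 : ℝ)) ∪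
    Finset.univ.image (fun i : Fin d => (-(d : ℝ)) • EuclideanSpace.single i (1 : ℝ)), ?_⟩
  intro z hz
  have hsum : ‖z‖ ≤ ∑ i, |z i| := by
    rw [EuclideanSpace.norm_eq]
    apply Real.sqrt_le_iff.2
    refine ⟨Finset.sum_nonneg fun _ _ => abs_nonneg _, ?_⟩
    have := Finset.sum_sq_le_sq_sum_of_nonneg (s := Finset.univ) (f := fun i => |z i|)
      (fun _ _ => abs_nonneg _)
    simpa using this
  have hex : ∃ i, ‖z‖ ≤ d * |z i| := by
    by_contra! hcon
    have hd : (Finset.univ : Finset (Fin d)).Nonempty := by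
      by_contra hne
      rw [Finset.not_nonempty_iff_eq_empty] at hne
      rw [hne] at hsum
      simp only [Finset.sum_empty] at hsum
      exact hz (norm_le_zero_iff.1 hsum)
    have h1 : ∑ i : Fin d, (d : ℝ) * |z i| < ∑ _i : Fin d, ‖z‖ :=
      Finset.sum_lt_sum_of_nonempty hd fun i _ => hcon i
    rw [← Finset.mul_sum, Finset.sum_const, Finset.card_univ, Fintype.card_fin, nsmul_eq_mul] at h1
    have := mul_le_mul_of_nonneg_left hsum (Nat.cast_nonneg (α := ℝ) d)
    linarith
  obtain ⟨i, hi⟩ := hex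
  have hinner : ∀ c : ℝ, inner ℝ (c • EuclideanSpace.single i (1 : ℝ)) z = c * z i := by
    intro c
    rw [real_inner_smul_left, EuclideanSpace.inner_single_left]
    simp
  rcases le_total 0 (z i) with h | h
  · refine ⟨(d : ℝ) • EuclideanSpace.single i (1 : ℝ), by simp, ?_⟩
    rw [hinner]
    rwa [abs_of_nonneg h] at hi
  · refine ⟨(-(d : ℝ)) • EuclideanSpace.single i (1 : ℝ), by simp, ?_⟩
    rw [hinner]
    rw [abs_of_nonpos h] at hi
    linarith

/-- Pointwise form of the Chernoff bound outside a ball, tilted by `l`. -/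
lemma indicator_exp_le_sum {d : ℕ} {V : Finset (E d)}
    (hV : ∀ z : E d, z ≠ 0 → ∃ v ∈ V, ‖z‖ ≤ inner ℝ v z) (l y z : E d) {c δ : ℝ} (hc : 0 < c)
    (hδ : 0 < δ) (τ : E d → ℝ) (hτ : ∀ v, 0 < τ v) (hz : δ ≤ ‖z - y‖) :
    Real.exp (c * inner ℝ l z) ≤ ∑ v ∈ V, Real.exp (-(c * (τ v * (δ + inner ℝ v y)))) *
      Real.exp (c * inner ℝ (l + τ v • v) z) := by
  have hne : z - y ≠ 0 := by
    intro h
    rw [h, norm_zero] at hz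
    linarith
  obtain ⟨v, hvV, hv⟩ := hV _ hne
  refine le_trans ?_ (Finset.single_le_sum (f := fun v =>
    Real.exp (-(c * (τ v * (δ + inner ℝ v y)))) * Real.exp (c * inner ℝ (l + τ v • v) z))
    (fun _ _ => by positivity) hvV)
  -- The two exponents differ by c τ (⟨v, z - y⟩ - δ), which is nonnegative for the vector v
  -- dominating z - y.
  rw [← Real.exp_add, Real.exp_le_exp, inner_add_left, real_inner_smul_left]
  rw [inner_sub_right] at hv
  have : 0 ≤ c * (τ v * (inner ℝ v z - inner ℝ v y - δ)) := by
    have := hτ v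
    have : 0 ≤ inner ℝ v z - inner ℝ v y - δ := by linarith
    positivity
  linarith

lemma tendsto_const_mul_exp_mul_neg {c : ℕ → ℝ} (hc : Tendsto c atTop atTop) {b : ℝ} (hb : b < 0)
    (K : ℝ) : Tendsto (fun n => K * Real.exp (c n * b)) atTop (𝓝 0) := by
  have := (Real.tendsto_exp_atBot.comp (hc.atTop_mul_const_of_neg hb)).const_mul K
  simpa using this

section GartnerEllis

variable {Ω : Type*} [MeasurableSpace Ω] {P : Measure Ω} [IsProbabilityMeasure P] {d : ℕ}
  {Z : ℕ → Ω → E d} {c : ℕ → ℝ} {Λ : E d → ℝ}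

/-- The scaled cumulant generating functions of `Z` at speed `c` converge to `Λ`. -/
structure ScaledCGFTendsto (P : Measure Ω) (Z : ℕ → Ω → E d) (c : ℕ → ℝ) (Λ : E d → ℝ) : Prop where
  measurable : ∀ n, Measurable (Z n)
  speed : Tendsto c atTop atTop
  integrable : ∀ l, ∀ᶠ n in atTop, Integrable (fun ω => Real.exp (c n * inner ℝ l (Z n ω))) P
  tendsto : ∀ l, Tendsto (fun n => (c n)⁻¹ * Real.log (∫ ω, Real.exp (c n * inner ℝ l (Z n ω)) ∂P))
    atTop (𝓝 (Λ l))

namespace ScaledCGFTendsto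

/-- Integrability is what permits undoing the logarithm: it makes the integral positive, while a
divergent one would have the default value 0. -/
lemma eventually_le (h : ScaledCGFTendsto P Z c Λ) (l : E d) {b : ℝ} (hb : Λ l < b) :
    ∀ᶠ n in atTop, ∫ ω, Real.exp (c n * inner ℝ l (Z n ω)) ∂P ≤ Real.exp (c n * b) := by
  filter_upwards [h.integrable l, (h.tendsto l).eventually_lt_const hb,
    h.speed.eventually_gt_atTop 0] with n hint hn hc
  rw [← Real.log_le_iff_le_exp (integral_exp_pos hint)]
  rw [inv_mul_lt_iff₀ hc] at hn
  exact hn.le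

lemma le_eventually (h : ScaledCGFTendsto P Z c Λ) (l : E d) {b : ℝ} (hb : b < Λ l) :
    ∀ᶠ n in atTop, Real.exp (c n * b) ≤ ∫ ω, Real.exp (c n * inner ℝ l (Z n ω)) ∂P := by
  filter_upwards [h.integrable l, (h.tendsto l).eventually_const_lt hb,
    h.speed.eventually_gt_atTop 0] with n hint hn hc
  rw [← Real.le_log_iff_exp_le (integral_exp_pos hint)]
  rw [lt_inv_mul_iff₀ hc] at hn
  exact hn.le

lemma map_zero (h : ScaledCGFTendsto P Z c Λ) : Λ 0 = 0 := by
  refine tendsto_nhds_unique (h.tendsto 0) ?_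
  simp

/-- Chernoff bound for small balls. -/
lemma ball_le (h : ScaledCGFTendsto P Z c Λ) (l x : E d) {b : ℝ}
    (hb : b < inner ℝ l x - Λ l) :
    ∃ r > 0, ∀ᶠ n in atTop, P.real {ω | Z n ω ∈ Metric.ball x r} ≤ Real.exp (-(c n * b)) := by
  set gap := inner ℝ l x - Λ l - b with hgap
  have hgap0 : 0 < gap := by linarith
  -- On this ball ⟨l, ·⟩ varies by at most half the gap; the other half pays for replacing the
  -- generating function by its limit. The added 1 covers l = 0.
  refine ⟨gap / (2 * (‖l‖ + 1)), by positivity, ?_⟩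
  have hΛ : Λ l < Λ l + gap / 2 := by linarith
  filter_upwards [h.integrable l, h.eventually_le l hΛ, h.speed.eventually_gt_atTop 0]
    with n hint hn hc
  have hms : MeasurableSet {ω | Z n ω ∈ Metric.ball x (gap / (2 * (‖l‖ + 1)))} :=
    h.measurable n Metric.isOpen_ball.measurableSet
  have hpt : ∀ ω, Set.indicator {ω | Z n ω ∈ Metric.ball x (gap / (2 * (‖l‖ + 1)))}
      (fun _ => Real.exp (c n * (inner ℝ l x - gap / 2))) ω
        ≤ Real.exp (c n * inner ℝ l (Z n ω)) := by
    intro ω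
    by_cases hω : ω ∈ {ω | Z n ω ∈ Metric.ball x (gap / (2 * (‖l‖ + 1)))}
    · rw [Set.indicator_of_mem hω, Real.exp_le_exp]
      have h1 : ‖Z n ω - x‖ < gap / (2 * (‖l‖ + 1)) := by
        simpa [dist_eq_norm] using hω
      have h2 : |inner ℝ l (Z n ω - x)| ≤ ‖l‖ * ‖Z n ω - x‖ := abs_real_inner_le_norm _ _
      have h3 : ‖l‖ * ‖Z n ω - x‖ ≤ (‖l‖ + 1) * (gap / (2 * (‖l‖ + 1))) := by
        gcongr
        linarith
      have h4 : (‖l‖ + 1) * (gap / (2 * (‖l‖ + 1))) = gap / 2 := by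
        field_simp
      rw [inner_sub_right] at h2
      have := (abs_le.1 (h2.trans (h3.trans h4.le))).1
      gcongr
      linarith
    · rw [Set.indicator_of_notMem hω]
      positivity
  have hle := integral_mono ((integrable_const _).indicator hms) hint hpt
  rw [integral_indicator_const _ hms, smul_eq_mul] at hle
  have hle' := hle.trans hn
  rw [← le_div_iff₀ (Real.exp_pos _), ← Real.exp_sub] at hle'
  refine hle'.trans (Real.exp_le_exp.2 (le_of_eq ?_))
  rw [hgap]
  ring

/-- Exponential tightness. -/
lemma compl_closedBall_le (h : ScaledCGFTendsto P Z c Λ) (b : ℝ) :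
    ∃ ρ > 0, ∃ N : ℝ, 0 < N ∧
      ∀ᶠ n in atTop, P.real {ω | ρ ≤ ‖Z n ω‖} ≤ N * Real.exp (-(c n * b)) := by
  obtain ⟨V, hV⟩ := exists_norming_finset d
  obtain ⟨K, hK⟩ : ∃ K, ∀ v ∈ V, Λ v < K := by
    obtain ⟨K, hK⟩ := (V.image Λ).bddAbove
    exact ⟨K + 1, fun v hv => (hK (Finset.mem_coe.2 (Finset.mem_image_of_mem _ hv))).trans_lt
      (lt_add_one _)⟩
  -- Each norming functional contributes exp(c(K - ρ)), so ρ ≥ K + b suffices. The 1 in the maximum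
  -- and the added 1 in the constant only ensure positivity.
  refine ⟨max 1 (K + b), by positivity, V.card + 1, by positivity, ?_⟩
  have hev : ∀ᶠ n in atTop, ∀ v ∈ V, Integrable (fun ω => Real.exp (c n * inner ℝ v (Z n ω))) P ∧
      ∫ ω, Real.exp (c n * inner ℝ v (Z n ω)) ∂P ≤ Real.exp (c n * K) := by
    rw [Filter.eventually_all_finset]
    exact fun v hv => (h.integrable v).and (h.eventually_le v (hK v hv))
  filter_upwards [hev, h.speed.eventually_gt_atTop 0] with n hn hc
  set ρ := max 1 (K + b)
  have hρ : 0 < ρ := lt_of_lt_of_le one_pos (le_max_left _ _)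
  have hms : MeasurableSet {ω | ρ ≤ ‖Z n ω‖} :=
    measurableSet_le measurable_const (h.measurable n).norm
  have hpt : ∀ ω, Set.indicator {ω | ρ ≤ ‖Z n ω‖} (fun _ => (1 : ℝ)) ω ≤
      ∑ v ∈ V, Real.exp (-(c n * ρ)) * Real.exp (c n * inner ℝ v (Z n ω)) := by
    intro ω
    by_cases hω : ω ∈ {ω | ρ ≤ ‖Z n ω‖}
    · rw [Set.indicator_of_mem hω]
      have := indicator_exp_le_sum hV 0 0 (Z n ω) hc hρ (fun _ => 1) (fun _ => one_pos)
        (by simpa using hω)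
      simpa using this
    · rw [Set.indicator_of_notMem hω]
      positivity
  have hle := integral_mono ((integrable_const _).indicator hms)
    (integrable_finsetSum V fun v hv => ((hn v hv).1.const_mul _)) hpt
  rw [integral_indicator_const _ hms, smul_eq_mul, mul_one,
    integral_finsetSum V fun v hv => ((hn v hv).1.const_mul _)] at hle
  refine hle.trans ?_
  calc ∑ v ∈ V, ∫ ω, Real.exp (-(c n * ρ)) * Real.exp (c n * inner ℝ v (Z n ω)) ∂P
      ≤ ∑ v ∈ V, Real.exp (-(c n * b)) := by
        refine Finset.sum_le_sum fun v hv => ?_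
        rw [integral_const_mul]
        refine (mul_le_mul_of_nonneg_left (hn v hv).2 (Real.exp_pos _).le).trans ?_
        rw [← Real.exp_add, Real.exp_le_exp]
        have : K + b ≤ ρ := le_max_right _ _
        nlinarith
    _ = V.card * Real.exp (-(c n * b)) := by rw [Finset.sum_const, nsmul_eq_mul]
    _ ≤ _ := by
        gcongr
        linarith

/-- Exponential upper bound for closed sets. -/
lemma closed_le (h : ScaledCGFTendsto P Z c Λ) {F : Set (E d)} (hF : IsClosed F) {b : ℝ}
    (hb : ∀ x ∈ F, (b : EReal) < fenchelLegendre Λ x) :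
    ∃ N : ℝ, 0 < N ∧ ∀ᶠ n in atTop, P.real {ω | Z n ω ∈ F} ≤ N * Real.exp (-(c n * b)) := by
  obtain ⟨ρ, -, N, hN, htight⟩ := h.compl_closedBall_le b
  have hloc : ∀ x : E d, ∃ r > 0, x ∈ F →
      ∀ᶠ n in atTop, P.real {ω | Z n ω ∈ Metric.ball x r} ≤ Real.exp (-(c n * b)) := by
    intro x
    by_cases hx : x ∈ F
    · obtain ⟨l, hl⟩ := lt_iSup_iff.1 (hb x hx)
      obtain ⟨r, hr, hr'⟩ := h.ball_le l x (EReal.coe_lt_coe_iff.1 hl)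
      exact ⟨r, hr, fun _ => hr'⟩
    · exact ⟨1, one_pos, fun hx' => absurd hx' hx⟩
  choose r hr hball using hloc
  -- Tightness leaves a compact piece of `F`, which finitely many Chernoff balls cover.
  have hcpt : IsCompact (F ∩ Metric.closedBall 0 ρ) :=
    (isCompact_closedBall 0 ρ).inter_left hF
  obtain ⟨t, htF, hcover⟩ := hcpt.elim_nhds_subcover (fun x => Metric.ball x (r x))
    (fun x _ => Metric.ball_mem_nhds x (hr x))
  refine ⟨t.card + N, by positivity, ?_⟩
  have hev : ∀ᶠ n in atTop, ∀ x ∈ t,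
      P.real {ω | Z n ω ∈ Metric.ball x (r x)} ≤ Real.exp (-(c n * b)) := by
    rw [Filter.eventually_all_finset]
    exact fun x hx => hball x (htF x hx).1
  filter_upwards [hev, htight] with n hn hn'
  have hsub : {ω | Z n ω ∈ F} ⊆
      (⋃ x ∈ t, {ω | Z n ω ∈ Metric.ball x (r x)}) ∪ {ω | ρ ≤ ‖Z n ω‖} := by
    intro ω hω
    by_cases hle : ρ ≤ ‖Z n ω‖
    · exact Or.inr hle
    · left
      have : Z n ω ∈ F ∩ Metric.closedBall 0 ρ := ⟨hω, by simpa using (not_le.1 hle).le⟩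
      simpa using hcover this
  calc P.real {ω | Z n ω ∈ F}
      ≤ P.real (⋃ x ∈ t, {ω | Z n ω ∈ Metric.ball x (r x)}) + P.real {ω | ρ ≤ ‖Z n ω‖} :=
        (measureReal_mono hsub).trans (measureReal_union_le _ _)
    _ ≤ ∑ x ∈ t, P.real {ω | Z n ω ∈ Metric.ball x (r x)} + N * Real.exp (-(c n * b)) :=
        add_le_add (measureReal_biUnion_finset_le _ _) hn'
    _ ≤ ∑ x ∈ t, Real.exp (-(c n * b)) + N * Real.exp (-(c n * b)) := by
        gcongr with x hx
        exact hn x hx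
    _ = _ := by
        rw [Finset.sum_const, nsmul_eq_mul]
        ring

/-- Exponential lower bound for balls around a gradient of `Λ`, by exponential tilting. -/
lemma le_ball (h : ScaledCGFTendsto P Z c Λ) (l y : E d)
    (hderiv : ∀ v, HasDerivAt (fun τ : ℝ => Λ (l + τ • v)) (inner ℝ v y) 0) {δ b : ℝ} (hδ : 0 < δ)
    (hb : inner ℝ l y - Λ l + ‖l‖ * δ < b) :
    ∀ᶠ n in atTop, Real.exp (-(c n * b)) ≤ P.real {ω | Z n ω ∈ Metric.ball y δ} := by
  obtain ⟨V, hV⟩ := exists_norming_finset d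
  -- The slope of Λ at l along v is ⟨v, y⟩, strictly below ⟨v, y⟩ + δ, so a small further tilt along
  -- v makes leaving the ball exponentially unlikely under the law tilted by l.
  have hτ : ∀ v, ∃ τ : ℝ, 0 < τ ∧ Λ (l + τ • v) < Λ l + τ * (δ + inner ℝ v y) := by
    intro v
    have h1 := (hasDerivAt_iff_tendsto_slope_zero.1 (hderiv v)).mono_left
      (nhdsWithin_mono 0 (fun x (hx : x ∈ Set.Ioi (0 : ℝ)) => ne_of_gt hx))
    have h2 := h1.eventually_lt_const (u := δ + inner ℝ v y) (by linarith)
    obtain ⟨τ, hτ, hτ0⟩ := (h2.and self_mem_nhdsWithin).exists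
    refine ⟨τ, hτ0, ?_⟩
    replace hτ0 : 0 < τ := hτ0
    simp only [zero_add, zero_smul, add_zero, smul_eq_mul] at hτ
    rw [inv_mul_lt_iff₀ hτ0] at hτ
    linarith
  choose τ hτ0 hτ using hτ
  set W : ℕ → E d → ℝ := fun n l => ∫ ω, Real.exp (c n * inner ℝ l (Z n ω)) ∂P with hW
  have hterm : ∀ v, Tendsto (fun n => Real.exp (-(c n * (τ v * (δ + inner ℝ v y)))) *
      W n (l + τ v • v) / W n l) atTop (𝓝 0) := by
    intro v
    -- The limiting exponent is -4g; errors of g in the numerator and in the denominator still leave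
    -- -2g.
    set g := (Λ l + τ v * (δ + inner ℝ v y) - Λ (l + τ v • v)) / 4 with hg
    have hg0 : 0 < g := by have := hτ v; rw [hg]; linarith
    have hup := h.eventually_le (l + τ v • v) (b := Λ (l + τ v • v) + g) (by linarith)
    have hlo := h.le_eventually l (b := Λ l - g) (by linarith)
    refine squeeze_zero' ?_ ?_ (tendsto_const_mul_exp_mul_neg h.speed (b := -2 * g) (by linarith) 1)
    · exact Eventually.of_forall fun n => div_nonneg (mul_nonneg (Real.exp_pos _).le
        (integral_nonneg fun _ => (Real.exp_pos _).le)) (integral_nonneg fun _ => (Real.exp_pos _).le)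
    · filter_upwards [hup, hlo] with n h1 h2
      rw [div_le_iff₀ ((Real.exp_pos _).trans_le h2), one_mul]
      calc Real.exp (-(c n * (τ v * (δ + inner ℝ v y)))) * W n (l + τ v • v)
          ≤ Real.exp (-(c n * (τ v * (δ + inner ℝ v y)))) *
              Real.exp (c n * (Λ (l + τ v • v) + g)) :=
            mul_le_mul_of_nonneg_left h1 (Real.exp_pos _).le
        _ = Real.exp (c n * (-2 * g)) * Real.exp (c n * (Λ l - g)) := by
            rw [← Real.exp_add, ← Real.exp_add, hg]
            congr 1
            ring
        _ ≤ _ := mul_le_mul_of_nonneg_left h2 (Real.exp_pos _).le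
  have hsum : Tendsto (fun n => ∑ v ∈ V, Real.exp (-(c n * (τ v * (δ + inner ℝ v y)))) *
      W n (l + τ v • v) / W n l) atTop (𝓝 0) := by
    simpa using tendsto_finsetSum V fun v _ => hterm v
  have hint : ∀ᶠ n in atTop, ∀ v ∈ V,
      Integrable (fun ω => Real.exp (c n * inner ℝ (l + τ v • v) (Z n ω))) P := by
    rw [Filter.eventually_all_finset]
    exact fun v _ => h.integrable _
  -- Half of the slack goes to the lower bound for the normalisation `W n l`, half to the factor 1/2
  -- lost outside the ball.
  set g := (b - (inner ℝ l y - Λ l + ‖l‖ * δ)) / 2 with hg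
  have hg0 : 0 < g := by rw [hg]; linarith
  have hhalf := (tendsto_const_mul_exp_mul_neg h.speed (b := -g) (by linarith) 1).eventually_lt_const
    (u := 1 / 2) (by norm_num)
  filter_upwards [hsum.eventually_lt_const (u := 1 / 2) (by norm_num), hint, h.integrable l,
    h.speed.eventually_gt_atTop 0, h.le_eventually l (b := Λ l - g) (by linarith), hhalf]
    with n hn hint hintl hc hlo hhalf
  set B : Set Ω := {ω | Z n ω ∈ Metric.ball y δ} with hB
  have hms : MeasurableSet B := h.measurable n Metric.isOpen_ball.measurableSet
  have hWpos : 0 < W n l := (Real.exp_pos _).trans_le hlo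
  have hpt : ∀ ω, Real.exp (c n * inner ℝ l (Z n ω)) ≤
      B.indicator (fun _ => Real.exp (c n * (inner ℝ l y + ‖l‖ * δ))) ω +
      ∑ v ∈ V, Real.exp (-(c n * (τ v * (δ + inner ℝ v y)))) *
        Real.exp (c n * inner ℝ (l + τ v • v) (Z n ω)) := by
    intro ω
    by_cases hω : ω ∈ B
    · rw [Set.indicator_of_mem hω]
      refine le_add_of_le_of_nonneg ?_ (by positivity)
      rw [Real.exp_le_exp]
      have h1 : ‖Z n ω - y‖ < δ := by simpa [hB, dist_eq_norm] using hω
      have h2 : inner ℝ l (Z n ω - y) ≤ ‖l‖ * ‖Z n ω - y‖ := real_inner_le_norm _ _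
      have h3 : ‖l‖ * ‖Z n ω - y‖ ≤ ‖l‖ * δ := by gcongr
      rw [inner_sub_right] at h2
      gcongr
      linarith
    · rw [Set.indicator_of_notMem hω, zero_add]
      refine indicator_exp_le_sum hV l y _ hc hδ τ hτ0 ?_
      simpa [hB, dist_eq_norm] using hω
  have hI1 : Integrable (B.indicator (fun _ => Real.exp (c n * (inner ℝ l y + ‖l‖ * δ)))) P :=
    (integrable_const _).indicator hms
  have hI2 : ∀ v ∈ V, Integrable (fun ω => Real.exp (-(c n * (τ v * (δ + inner ℝ v y)))) *
        Real.exp (c n * inner ℝ (l + τ v • v) (Z n ω))) P := fun v hv => (hint v hv).const_mul _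
  have hle := integral_mono hintl (hI1.add (integrable_finsetSum V hI2)) hpt
  simp only [Pi.add_apply] at hle
  rw [integral_add hI1 (integrable_finsetSum V hI2), integral_indicator_const _ hms, smul_eq_mul,
    integral_finsetSum V hI2] at hle
  simp only [integral_const_mul] at hle
  rw [← Finset.sum_div, div_lt_iff₀ hWpos] at hn
  have h5 : W n l / 2 ≤ P.real B * Real.exp (c n * (inner ℝ l y + ‖l‖ * δ)) := by
    have : W n l ≤ P.real B * Real.exp (c n * (inner ℝ l y + ‖l‖ * δ)) +
      ∑ v ∈ V, Real.exp (-(c n * (τ v * (δ + inner ℝ v y)))) * W n (l + τ v • v) := hle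
    linarith
  rw [← div_le_iff₀ (Real.exp_pos _)] at h5
  refine le_trans ?_ h5
  rw [le_div_iff₀ (Real.exp_pos _)]
  calc Real.exp (-(c n * b)) * Real.exp (c n * (inner ℝ l y + ‖l‖ * δ))
      = Real.exp (c n * (Λ l - g)) * Real.exp (c n * -g) := by
        rw [← Real.exp_add, ← Real.exp_add]
        congr 1
        have : b = 2 * g + (inner ℝ l y - Λ l + ‖l‖ * δ) := by rw [hg]; ring
        rw [this]
        ring
    _ ≤ W n l * (1 / 2) := by
        refine mul_le_mul hlo ?_ (Real.exp_pos _).le hWpos.le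
        linarith
    _ = W n l / 2 := by ring

end ScaledCGFTendsto

/-- A point at which the Fenchel–Legendre transform is at most `K` is a limit of gradients `y'` of
`Λ` at points `l` whose value `⟨l, y'⟩ - Λ l` is at most `K`. -/
lemma exists_gradient_near {Λ' : E d → E d} (h0 : Λ 0 = 0)
    (hderiv : ∀ l, HasGradientAt Λ (Λ' l) l) {y : E d} {K : ℝ}
    (hK : fenchelLegendre Λ y ≤ K) {δ : ℝ} (hδ : 0 < δ) :
    ∃ l, ‖Λ' l - y‖ < δ ∧ inner ℝ l (Λ' l) - Λ l ≤ K := by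
  have hle : ∀ l, inner ℝ l y - Λ l ≤ K := fun l =>
    EReal.coe_le_coe_iff.1 ((le_iSup (fun l : E d => ((inner ℝ l y - Λ l : ℝ) : EReal)) l).trans hK)
  have hK0 : 0 ≤ K := by simpa [h0] using hle 0
  -- Chosen so that 2εK < δ². The minimiser l will satisfy ε‖l‖²/2 ≤ K, and y differs from the
  -- gradient by ε l, of squared norm at most 2εK.
  set ε := δ ^ 2 / (2 * K + 1) / 2 with hε
  have hε0 : 0 < ε := by positivity
  set f : E d → ℝ := fun l => Λ l - inner ℝ l y + ε / 2 * ‖l‖ ^ 2 with hf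
  have hcont : Continuous f := by
    have : Continuous Λ := continuous_iff_continuousAt.2 fun l => (hderiv l).continuousAt
    fun_prop
  -- The bound on the transform at y says that Λ - ⟨·, y⟩ is at least -K, so the quadratic term
  -- forces coercivity.
  have hcoer : Tendsto f (cocompact (E d)) atTop := by
    have h1 : Tendsto (fun l : E d => -K + ε / 2 * ‖l‖ ^ 2) (cocompact (E d)) atTop := by
      refine tendsto_atTop_add_const_left _ _ (Tendsto.const_mul_atTop (by positivity) ?_)
      exact (tendsto_pow_atTop two_ne_zero).comp (tendsto_norm_cocompact_atTop)
    refine tendsto_atTop_mono (fun l => ?_) h1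
    have := hle l
    simp only [hf]
    linarith
  obtain ⟨l, hl⟩ := hcont.exists_forall_le hcoer
  have hgrad : ∀ v : E d, inner ℝ (Λ' l) v - inner ℝ v y + ε * inner ℝ l v = 0 := by
    intro v
    have hline : HasDerivAt (fun t : ℝ => l + t • v) v 0 := by
      simpa using ((hasDerivAt_id (0 : ℝ)).smul_const v).const_add l
    have e1 : HasDerivAt (fun t : ℝ => Λ (l + t • v)) (inner ℝ (Λ' l) v) 0 := by
      have hΛ : HasFDerivAt Λ (InnerProductSpace.toDual ℝ (E d) (Λ' l)) (l + (0 : ℝ) • v) := by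
        simpa using (hderiv l).hasFDerivAt
      simpa [Function.comp_def] using hΛ.comp_hasDerivAt (0 : ℝ) hline
    have e2 : HasDerivAt (fun t : ℝ => (inner ℝ (l + t • v) y : ℝ)) (inner ℝ v y) 0 := by
      simpa using hline.inner ℝ (hasDerivAt_const (0 : ℝ) y)
    have e3 : HasDerivAt (fun t : ℝ => ‖l + t • v‖ ^ 2) (2 * inner ℝ l v) 0 := by
      simpa using hline.norm_sq
    have e : HasDerivAt (fun t : ℝ => f (l + t • v))
        (inner ℝ (Λ' l) v - inner ℝ v y + ε / 2 * (2 * inner ℝ l v)) 0 :=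
      (e1.sub e2).add (e3.const_mul _)
    have hmin : IsLocalMin (fun t : ℝ => f (l + t • v)) 0 :=
      Eventually.of_forall fun t => by simpa using hl (l + t • v)
    have := hmin.hasDerivAt_eq_zero e
    linarith
  have hΛ' : Λ' l = y - ε • l := by
    rw [← sub_eq_zero, ← inner_self_eq_zero (𝕜 := ℝ)]
    have := hgrad (Λ' l - (y - ε • l))
    rw [real_inner_comm y, ← real_inner_smul_left, ← inner_sub_left, ← inner_add_left] at this
    rw [← this]
    congr 1
    abel
  -- Comparison of the minimum with the value at 0, which is 0.
  have hbound : ε / 2 * ‖l‖ ^ 2 ≤ K := by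
    have h1 := hl 0
    have h2 := hle l
    simp only [hf, h0, inner_zero_left, norm_zero] at h1
    norm_num at h1
    linarith
  refine ⟨l, ?_, ?_⟩
  · rw [hΛ', sub_sub_cancel_left, norm_neg, norm_smul, Real.norm_of_nonneg hε0.le]
    refine lt_of_pow_lt_pow_left₀ 2 hδ.le ?_
    calc (ε * ‖l‖) ^ 2 = 2 * ε * (ε / 2 * ‖l‖ ^ 2) := by ring
      _ ≤ 2 * ε * K := by gcongr
      _ = δ ^ 2 * (K / (2 * K + 1)) := by rw [hε]; field_simp
      _ < δ ^ 2 * 1 := by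
        gcongr
        rw [div_lt_one (by positivity)]
        linarith
      _ = δ ^ 2 := mul_one _
  · rw [hΛ', inner_sub_right, real_inner_smul_right, real_inner_self_eq_norm_sq]
    have := hle l
    have : 0 ≤ ε * ‖l‖ ^ 2 := by positivity
    linarith

/-- The Gärtner–Ellis theorem for a limit `Λ` that is finite and differentiable everywhere. -/
theorem isLDP_of_scaledCGFTendsto (h : ScaledCGFTendsto P Z c Λ) {Λ' : E d → E d}
    (hderiv : ∀ l, HasGradientAt Λ (Λ' l) l) : IsLDP P Z c (fenchelLegendre Λ) where
  nonneg x := by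
    refine le_trans ?_ (le_iSup (fun l : E d => ((inner ℝ l x - Λ l : ℝ) : EReal)) 0)
    simp [h.map_zero]
  lsc := by
    refine lowerSemicontinuous_iSup fun l => Continuous.lowerSemicontinuous ?_
    exact continuous_coe_real_ereal.comp (by fun_prop)
  lower A _ := by
    rw [EReal.neg_le]
    refine le_iInf₂ fun y hy => ?_
    rw [← EReal.le_of_forall_lt_iff_le]
    intro b hb
    obtain ⟨K, hK1, hK2⟩ := EReal.lt_iff_exists_real_btwn.1 hb
    rw [EReal.coe_lt_coe_iff] at hK2
    obtain ⟨r, hr, hrA⟩ := Metric.isOpen_iff.1 isOpen_interior y hy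
    obtain ⟨l, hl1, hl2⟩ := exists_gradient_near h.map_zero hderiv hK1.le (half_pos hr)
    -- The first entry keeps the ball around the gradient inside `A`; the second keeps the tilting
    -- error ‖l‖δ below b - K.
    set δ := min (r / 2) ((b - K) / (2 * (‖l‖ + 1))) with hδ
    have hδ0 : 0 < δ := lt_min (half_pos hr) (div_pos (by linarith) (by positivity))
    have hlδ : ‖l‖ * δ < b - K := by
      calc ‖l‖ * δ ≤ (‖l‖ + 1) * ((b - K) / (2 * (‖l‖ + 1))) :=
            mul_le_mul (by linarith) (min_le_right _ _) hδ0.le (by positivity)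
        _ = (b - K) / 2 := by field_simp
        _ < b - K := by linarith
    have hdir : ∀ v, HasDerivAt (fun τ : ℝ => Λ (l + τ • v)) (inner ℝ v (Λ' l)) 0 := by
      intro v
      have hline : HasDerivAt (fun t : ℝ => l + t • v) v 0 := by
        simpa using ((hasDerivAt_id (0 : ℝ)).smul_const v).const_add l
      have hΛ : HasFDerivAt Λ (InnerProductSpace.toDual ℝ (E d) (Λ' l)) (l + (0 : ℝ) • v) := by
        simpa using (hderiv l).hasFDerivAt
      rw [real_inner_comm]
      simpa [Function.comp_def] using hΛ.comp_hasDerivAt (0 : ℝ) hline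
    have hev := h.le_ball l (Λ' l) hdir hδ0 (b := b) (by linarith)
    rw [EReal.neg_le, ← EReal.coe_neg]
    refine le_liminf_of_le (by isBoundedDefault) ?_
    filter_upwards [hev, h.speed.eventually_gt_atTop 0] with n hn hc
    have hsub : {ω | Z n ω ∈ Metric.ball (Λ' l) δ} ⊆ {ω | Z n ω ∈ A} := by
      intro ω hω
      refine interior_subset (s := A) (hrA ?_)
      have h1 : dist (Z n ω) (Λ' l) < r / 2 := lt_of_lt_of_le hω (min_le_left _ _)
      have h2 : dist (Λ' l) y < r / 2 := by rwa [dist_eq_norm]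
      exact lt_of_le_of_lt (dist_triangle _ _ _) (by linarith)
    have h1 : Real.exp (-(c n * b)) ≤ P.real {ω | Z n ω ∈ A} := hn.trans (measureReal_mono hsub)
    have h2 : ENNReal.ofReal (Real.exp (-(c n * b))) ≤ P {ω | Z n ω ∈ A} :=
      ENNReal.ofReal_le_of_le_toReal h1
    have h3 := ENNReal.log_monotone h2
    rw [ENNReal.log_ofReal_of_pos (Real.exp_pos _), Real.log_exp] at h3
    calc ((-b : ℝ) : EReal) = (((c n)⁻¹ : ℝ) : EReal) * ((-(c n * b) : ℝ) : EReal) := by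
          rw [← EReal.coe_mul]
          congr 1
          field_simp
      _ ≤ _ := mul_le_mul_of_nonneg_left h3 (EReal.coe_nonneg.2 (inv_nonneg.2 hc.le))
  upper A _ := by
    rw [EReal.le_neg]
    rw [← EReal.ge_of_forall_gt_iff_ge]
    intro b hb
    obtain ⟨N, hN, hev⟩ := h.closed_le (F := closure A) isClosed_closure (b := b)
      (fun x hx => hb.trans_le (iInf₂_le x hx))
    rw [EReal.le_neg, ← EReal.coe_neg, ← EReal.le_of_forall_lt_iff_le]
    intro b' hb'
    rw [EReal.coe_lt_coe_iff] at hb'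
    refine limsup_le_of_le (by isBoundedDefault) ?_
    -- The strict inequality b' > -b leaves an exponential margin that absorbs the constant N.
    have hN' := (tendsto_const_mul_exp_mul_neg h.speed (b := -(b' + b)) (by linarith) N).eventually_lt_const one_pos
    filter_upwards [hev, hN', h.speed.eventually_gt_atTop 0] with n hn hN' hc
    have h1 : P.real {ω | Z n ω ∈ A} ≤ Real.exp (c n * b') := by
      refine (measureReal_mono (s₂ := {ω | Z n ω ∈ closure A})
        (fun ω hω => subset_closure (s := A) hω)).trans (hn.trans ?_)
      calc N * Real.exp (-(c n * b)) = N * Real.exp (c n * -(b' + b)) * Real.exp (c n * b') := by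
            rw [mul_assoc, ← Real.exp_add]
            congr 2
            ring
        _ ≤ 1 * Real.exp (c n * b') := by gcongr
        _ = _ := one_mul _
    have h2 : P {ω | Z n ω ∈ A} ≤ ENNReal.ofReal (Real.exp (c n * b')) := by
      rw [← ofReal_measureReal]
      exact ENNReal.ofReal_le_ofReal h1
    have h3 := ENNReal.log_monotone h2
    rw [ENNReal.log_ofReal_of_pos (Real.exp_pos _), Real.log_exp] at h3
    calc _ ≤ (((c n)⁻¹ : ℝ) : EReal) * ((c n * b' : ℝ) : EReal) :=
          mul_le_mul_of_nonneg_left h3 (EReal.coe_nonneg.2 (inv_nonneg.2 hc.le))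
      _ = b' := by
          rw [← EReal.coe_mul]
          congr 1
          field_simp

end GartnerEllis

end TruncatedTails

namespace TruncatedTails

/-! ### Integrals of functions of the direction over the tails of a measure -/

section TailIntegral

variable {d : ℕ}

/-- The integral of `φ (x / ‖x‖)` over the set `r < ‖x‖`. -/
noncomputable def tailIntegral (m : Measure (E d)) (φ : E d → ℝ) (r : ℝ) : ℝ :=
  ∫ x in {x | r < ‖x‖}, φ (‖x‖⁻¹ • x) ∂m

lemma norm_direction {x : E d} (hx : x ≠ 0) : ‖‖x‖⁻¹ • x‖ = 1 := by
  rw [norm_smul, norm_inv, norm_norm, inv_mul_cancel₀ (norm_ne_zero_iff.2 hx)]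

lemma norm_direction_of_lt {x : E d} {r : ℝ} (hr : 0 ≤ r) (hx : r < ‖x‖) : ‖‖x‖⁻¹ • x‖ = 1 :=
  norm_direction (norm_pos_iff.1 (hr.trans_lt hx))

lemma direction_smul {t : ℝ} (ht : 0 < t) (x : E d) : ‖t • x‖⁻¹ • (t • x) = ‖x‖⁻¹ • x := by
  rw [norm_smul, Real.norm_of_nonneg ht.le, smul_smul, mul_inv]
  congr 1
  field_simp

lemma measurableSet_lt_norm (r : ℝ) : MeasurableSet {x : E d | r < ‖x‖} :=
  measurableSet_lt measurable_const measurable_norm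

lemma measurable_direction : Measurable (fun x : E d => ‖x‖⁻¹ • x) := by fun_prop

lemma exists_bound_on_sphere {φ : E d → ℝ} (hφ : Continuous φ) :
    ∃ K, 0 ≤ K ∧ ∀ x, ‖x‖ = 1 → |φ x| ≤ K := by
  obtain ⟨K, hK⟩ := (isCompact_sphere (0 : E d) 1).exists_bound_of_continuousOn hφ.continuousOn
  exact ⟨max K 0, le_max_right _ _, fun x hx => (hK x (by simpa using hx)).trans (le_max_left _ _)⟩

variable {m : Measure (E d)} {φ ψ : E d → ℝ} {r : ℝ}

lemma integrableOn_direction (hm : m {x | r < ‖x‖} < ⊤) (hφ : Continuous φ) (hr : 0 ≤ r) :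
    IntegrableOn (fun x => φ (‖x‖⁻¹ • x)) {x | r < ‖x‖} m := by
  obtain ⟨K, -, hK⟩ := exists_bound_on_sphere hφ
  refine IntegrableOn.of_bound hm (hφ.measurable.comp measurable_direction).aestronglyMeasurable K ?_
  rw [ae_restrict_iff' (measurableSet_lt_norm r)]
  exact Eventually.of_forall fun x hx => hK _ (norm_direction_of_lt hr hx)

lemma abs_tailIntegral_le (hm : m {x | r < ‖x‖} < ⊤) (hr : 0 ≤ r) {K : ℝ}
    (hK : ∀ x, ‖x‖ = 1 → |φ x| ≤ K) : |tailIntegral m φ r| ≤ K * m.real {x | r < ‖x‖} :=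
  norm_setIntegral_le_of_norm_le_const (f := fun x => φ (‖x‖⁻¹ • x)) hm
    (fun _ hx => hK _ (norm_direction_of_lt hr hx))

lemma tailIntegral_one : tailIntegral m (fun _ => 1) r = m.real {x | r < ‖x‖} := by
  simp [tailIntegral]

lemma tailIntegral_sub (hm : m {x | r < ‖x‖} < ⊤) (hφ : Continuous φ) (hψ : Continuous ψ)
    (hr : 0 ≤ r) :
    tailIntegral m (fun x => φ x - ψ x) r = tailIntegral m φ r - tailIntegral m ψ r :=
  integral_sub (integrableOn_direction hm hφ hr) (integrableOn_direction hm hψ hr)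

lemma tailIntegral_nonneg (hφ0 : ∀ x, 0 ≤ φ x) : 0 ≤ tailIntegral m φ r :=
  integral_nonneg fun _ => hφ0 _

lemma tailIntegral_anti (hm : m {x | r < ‖x‖} < ⊤) (hφ : Continuous φ) (hφ0 : ∀ x, 0 ≤ φ x)
    (hr : 0 ≤ r) {s : ℝ} (hrs : r ≤ s) : tailIntegral m φ s ≤ tailIntegral m φ r :=
  setIntegral_mono_set (integrableOn_direction hm hφ hr) (Eventually.of_forall fun _ => hφ0 _)
    (Eventually.of_forall fun _ hx => lt_of_le_of_lt hrs hx)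

/-- Dilations preserve directions, so rescaling the measure only moves the threshold. -/
lemma tailIntegral_map_smul {t : ℝ} (ht : 0 < t) (hφ : Continuous φ) :
    tailIntegral (m.map (fun x => t⁻¹ • x)) φ r = tailIntegral m φ (t * r) := by
  have hmeas : Measurable (fun x : E d => t⁻¹ • x) := measurable_const_smul _
  have hφm : AEStronglyMeasurable (fun x => φ (‖x‖⁻¹ • x)) (m.map (fun x => t⁻¹ • x)) :=
    (hφ.measurable.comp measurable_direction).aestronglyMeasurable
  rw [tailIntegral, setIntegral_map (measurableSet_lt_norm r) hφm hmeas.aemeasurable]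
  simp only [direction_smul (inv_pos.2 ht)]
  congr 2
  ext x
  simp only [Set.mem_preimage, Set.mem_ofPred_eq, norm_smul, norm_inv, Real.norm_of_nonneg ht.le]
  rw [lt_inv_mul_iff₀ ht]

lemma IsTailIndex.map_smul {μ : Measure (E d)} {α : ℝ} (h : IsTailIndex μ α) {t : ℝ} (ht : 0 < t) :
    μ.map (fun x => t⁻¹ • x) = ENNReal.ofReal (t ^ (-α)) • μ := by
  ext A hA
  rw [Measure.map_apply (measurable_const_smul _) hA, Measure.smul_apply, smul_eq_mul,
    ← h.2 t ht A hA]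
  congr 1
  ext x
  simp only [Set.mem_preimage, Set.mem_image]
  constructor
  · intro hx
    exact ⟨_, hx, by rw [smul_smul, mul_inv_cancel₀ ht.ne', one_smul]⟩
  · rintro ⟨y, hy, rfl⟩
    rwa [smul_smul, inv_mul_cancel₀ ht.ne', one_smul]

lemma IsTailIndex.tailIntegral_eq {μ : Measure (E d)} {α : ℝ} (h : IsTailIndex μ α)
    (hφ : Continuous φ) (hr : 0 < r) : tailIntegral μ φ r = r ^ (-α) * tailIntegral μ φ 1 := by
  have := tailIntegral_map_smul (m := μ) (r := 1) hr hφ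
  rw [mul_one] at this
  rw [← this, h.map_smul hr, tailIntegral, tailIntegral, Measure.restrict_smul,
    integral_smul_measure, ENNReal.toReal_ofReal (by positivity), smul_eq_mul]

end TailIntegral

/-! ### Vague convergence tested on functions of the direction -/

section Vague

variable {d : ℕ}

lemma measurable_radial : Measurable (radial : E d → E d) := by
  unfold radial
  fun_prop

lemma norm_radial (x : E d) : ‖radial x‖ = ‖x‖ / (1 + ‖x‖) := by
  rw [radial, norm_smul, norm_inv, Real.norm_of_nonneg (by positivity)]
  field_simp

/-- The condition F 0 = 0 makes up for the origin, which the punctured space omits. -/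
lemma integral_extend (m : Measure (E d)) {F : E d → ℝ} (hF : Measurable F) (h0 : F 0 = 0) :
    ∫ y : PuncturedExt d, F y ∂(extend m) = ∫ x, F (radial x) ∂m := by
  have hs : MeasurableSet {y : E d | ‖y‖ ≤ 1 ∧ y ≠ 0} :=
    (measurableSet_le measurable_norm measurable_const).inter (measurableSet_singleton 0).compl
  refine (integral_subtype_comap (μ := m.map radial) hs F).trans ?_
  rw [setIntegral_map hs hF.aestronglyMeasurable measurable_radial.aemeasurable]
  refine setIntegral_eq_integral_of_forall_compl_eq_zero fun x hx => ?_
  have : radial x = 0 := by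
    by_contra hne
    refine hx ⟨?_, hne⟩
    rw [norm_radial, div_le_one (by positivity)]
    linarith
  rw [this, h0]

/-- A continuous radial cutoff, vanishing up to `u` and equal to one from `v` on. -/
noncomputable def cutoff (u v t : ℝ) : ℝ := max 0 (min 1 ((t - u) / (v - u)))

lemma continuous_cutoff (u v : ℝ) : Continuous (cutoff u v) := by
  unfold cutoff
  fun_prop

lemma cutoff_nonneg (u v t : ℝ) : 0 ≤ cutoff u v t := le_max_left _ _

lemma cutoff_le_one (u v t : ℝ) : cutoff u v t ≤ 1 := max_le zero_le_one (min_le_left _ _)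

lemma cutoff_eq_zero {u v t : ℝ} (huv : u < v) (ht : t ≤ u) : cutoff u v t = 0 := by
  refine max_eq_left ((min_le_right _ _).trans ?_)
  exact div_nonpos_of_nonpos_of_nonneg (by linarith) (by linarith)

lemma cutoff_eq_one {u v t : ℝ} (huv : u < v) (ht : v ≤ t) : cutoff u v t = 1 := by
  unfold cutoff
  rw [min_eq_left, max_eq_right zero_le_one]
  rw [le_div_iff₀ (by linarith)]
  linarith

/-- The test function `φ (y / ‖y‖)` cut off radially. -/
noncomputable def sectorTest (φ : E d → ℝ) (u v : ℝ) (y : E d) : ℝ :=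
  φ (‖y‖⁻¹ • y) * cutoff u v ‖y‖

lemma continuous_sectorTest {φ : E d → ℝ} (hφ : Continuous φ) (u v : ℝ) :
    Continuous (fun y : PuncturedExt d => sectorTest φ u v y) := by
  unfold sectorTest
  have h1 : Continuous (fun y : PuncturedExt d => ‖(y : E d)‖⁻¹) :=
    Continuous.inv₀ (by fun_prop) fun y => norm_ne_zero_iff.2 y.2.2
  have h2 := continuous_cutoff u v
  fun_prop

/-- The closed annulus u ≤ ‖y‖ ≤ 1 is compact and includes the sphere at infinity, so a test
function need not decay at infinity: this is what gives access to whole tails. -/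
lemma hasCompactSupport_sectorTest (φ : E d → ℝ) {u v : ℝ} (hu : 0 < u) (huv : u < v) :
    HasCompactSupport (fun y : PuncturedExt d => sectorTest φ u v y) := by
  have hK : IsCompact (Subtype.val ⁻¹' {y : E d | u ≤ ‖y‖} : Set (PuncturedExt d)) := by
    rw [Subtype.isCompact_iff]
    have : {y : E d | ‖y‖ ≤ 1 ∧ y ≠ 0} ∩ {y : E d | u ≤ ‖y‖} =
        Metric.closedBall 0 1 ∩ {y | u ≤ ‖y‖} := by
      ext y
      simp only [Set.mem_inter_iff, Set.mem_ofPred_eq, mem_closedBall_zero_iff]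
      constructor
      · rintro ⟨⟨h1, -⟩, h2⟩
        exact ⟨h1, h2⟩
      · rintro ⟨h1, h2⟩
        exact ⟨⟨h1, norm_pos_iff.1 (hu.trans_le h2)⟩, h2⟩
    have himage := Subtype.image_preimage_coe {y : E d | ‖y‖ ≤ 1 ∧ y ≠ 0} {y : E d | u ≤ ‖y‖}
    rw [this] at himage
    refine (congrArg IsCompact himage).mpr ?_
    exact (isCompact_closedBall 0 1).inter_right (isClosed_le continuous_const continuous_norm)
  refine HasCompactSupport.intro hK fun y hy => ?_
  have : ‖(y : E d)‖ ≤ u := (not_le.1 hy).le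
  simp [sectorTest, cutoff_eq_zero huv this]

lemma measurable_sectorTest {φ : E d → ℝ} (hφ : Continuous φ) (u v : ℝ) :
    Measurable (sectorTest φ u v) :=
  (hφ.measurable.comp measurable_direction).mul
    ((continuous_cutoff u v).measurable.comp measurable_norm)

lemma direction_radial (x : E d) : ‖radial x‖⁻¹ • radial x = ‖x‖⁻¹ • x :=
  direction_smul (by positivity) x

lemma div_one_add_lt {r s : ℝ} (hr : 0 ≤ r) (hrs : r < s) : r / (1 + r) < s / (1 + s) := by
  rw [div_lt_div_iff₀ (by linarith) (by linarith)]
  linarith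

lemma div_one_add_le {r s : ℝ} (hr : 0 ≤ r) (hrs : r ≤ s) : r / (1 + r) ≤ s / (1 + s) := by
  rw [div_le_div_iff₀ (by linarith) (by linarith)]
  linarith

/-- The integral of a radially cut off test function lies between two tail integrals. -/
lemma tailIntegral_le_sectorTest_le {m : Measure (E d)} (hm : ∀ r, 0 < r → m {x | r < ‖x‖} < ⊤)
    {φ : E d → ℝ} (hφ : Continuous φ) (hφ0 : ∀ x, 0 ≤ φ x) {r s : ℝ} (hr : 0 < r) (hrs : r < s) :
    tailIntegral m φ s ≤ ∫ x, sectorTest φ (r / (1 + r)) (s / (1 + s)) (radial x) ∂m ∧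
    ∫ x, sectorTest φ (r / (1 + r)) (s / (1 + s)) (radial x) ∂m ≤ tailIntegral m φ r := by
  -- The model of the compactification sends radius r to r/(1+r), so the cutoff rises exactly
  -- between the radii r and s.
  have huv := div_one_add_lt hr.le hrs
  have hI : ∀ t, 0 < t →
      Integrable ({x : E d | t < ‖x‖}.indicator fun x => φ (‖x‖⁻¹ • x)) m := fun t ht =>
    (integrable_indicator_iff (measurableSet_lt_norm t)).2 (integrableOn_direction (hm t ht) hφ ht.le)
  have hup : ∀ x : E d, sectorTest φ (r / (1 + r)) (s / (1 + s)) (radial x) ≤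
      {x : E d | r < ‖x‖}.indicator (fun x => φ (‖x‖⁻¹ • x)) x := by
    intro x
    rw [sectorTest, direction_radial, norm_radial]
    by_cases hx : r < ‖x‖
    · rw [Set.indicator_of_mem (by exact hx)]
      exact mul_le_of_le_one_right (hφ0 _) (cutoff_le_one _ _ _)
    · rw [Set.indicator_of_notMem (by exact hx),
        cutoff_eq_zero huv (div_one_add_le (norm_nonneg x) (not_lt.1 hx)), mul_zero]
  have hlo : ∀ x : E d, {x : E d | s < ‖x‖}.indicator (fun x => φ (‖x‖⁻¹ • x)) x ≤
      sectorTest φ (r / (1 + r)) (s / (1 + s)) (radial x) := by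
    intro x
    rw [sectorTest, direction_radial, norm_radial]
    by_cases hx : s < ‖x‖
    · rw [Set.indicator_of_mem (by exact hx),
        cutoff_eq_one huv (div_one_add_le (hr.trans hrs).le (le_of_lt hx)), mul_one]
    · rw [Set.indicator_of_notMem (by exact hx)]
      exact mul_nonneg (hφ0 _) (cutoff_nonneg _ _ _)
  have hT : Integrable
      (fun x => sectorTest φ (r / (1 + r)) (s / (1 + s)) (radial x)) m := by
    refine (hI r hr).mono'
      ((measurable_sectorTest hφ _ _).comp measurable_radial).aestronglyMeasurable
      (Eventually.of_forall fun x => ?_)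
    exact (Real.norm_of_nonneg (mul_nonneg (hφ0 _) (cutoff_nonneg _ _ _))).trans_le (hup x)
  rw [tailIntegral, tailIntegral, ← integral_indicator (measurableSet_lt_norm s),
    ← integral_indicator (measurableSet_lt_norm r)]
  exact ⟨integral_mono (hI s (hr.trans hrs)) hT hlo, integral_mono hT (hI r hr) hup⟩

variable {Ω : Type*} [MeasurableSpace Ω] {P : Measure Ω}
  {H : Ω → E d} {a : ℕ → ℝ} {μ : Measure (E d)} {α : ℝ}

lemma HasPowerLawTail.tendsto_sectorTest (h : HasPowerLawTail P H a μ) (hH : Measurable H)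
    {φ : E d → ℝ} (hφ : Continuous φ) {u v : ℝ} (hu : 0 < u) (huv : u < v) :
    Tendsto (fun n : ℕ => (n : ℝ) *
        ∫ x, sectorTest φ u v (radial x) ∂((P.map H).map (fun x => (a n)⁻¹ • x)))
      atTop (𝓝 (∫ x, sectorTest φ u v (radial x) ∂μ)) := by
  have h0 : sectorTest φ u v 0 = 0 := by simp [sectorTest, cutoff_eq_zero huv hu.le]
  have := h.vague _ (continuous_sectorTest hφ u v) (hasCompactSupport_sectorTest φ hu huv)
  simp only [integral_extend _ (measurable_sectorTest hφ u v) h0, integral_smul_measure] at this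
  refine this.congr fun n => ?_
  rw [Measure.map_map (measurable_const_smul _) hH]
  simp [Function.comp_def]

/-- Tail integrals along the normalizing sequence. -/
lemma HasPowerLawTail.tendsto_tailIntegral_seq [IsProbabilityMeasure P] (h : HasPowerLawTail P H a μ) (hH : Measurable H)
    (hα : IsTailIndex μ α) {φ : E d → ℝ} (hφ : Continuous φ) (hφ0 : ∀ x, 0 ≤ φ x) {r : ℝ}
    (hr : 0 < r) :
    Tendsto (fun n : ℕ => (n : ℝ) * tailIntegral (P.map H) φ (a n * r)) atTop
      (𝓝 (r ^ (-α) * tailIntegral μ φ 1)) := by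
  have : IsProbabilityMeasure (P.map H) := Measure.isProbabilityMeasure_map hH.aemeasurable
  -- Homogeneity makes the limiting tail continuous in the radius. A test function cut off between r
  -- and a nearby t then loses arbitrarily little, with t > r for the lower bound and t < r for the
  -- upper.
  have hcont : ContinuousAt (fun s : ℝ => s ^ (-α) * tailIntegral μ φ 1) r :=
    (Real.continuousAt_rpow_const r (-α) (Or.inl hr.ne')).mul continuousAt_const
  have hpos : ∀ s t : ℝ, 0 < s → s < t → 0 < s / (1 + s) ∧ s / (1 + s) < t / (1 + t) :=
    fun s t hs hst => ⟨by positivity, div_one_add_lt hs.le hst⟩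
  refine tendsto_order.2 ⟨fun b hb => ?_, fun b hb => ?_⟩
  · have hev := (hcont.eventually (lt_mem_nhds hb)).filter_mono
      (nhdsWithin_le_nhds (s := Set.Ioi r))
    obtain ⟨t, ht, hrt⟩ := (hev.and self_mem_nhdsWithin).exists
    replace hrt : r < t := hrt
    rw [← hα.tailIntegral_eq hφ (hr.trans hrt)] at ht
    have ht' := ht.trans_le (tailIntegral_le_sectorTest_le h.radon hφ hφ0 hr hrt).1
    filter_upwards [(h.tendsto_sectorTest hH hφ (hpos r t hr hrt).1
      (hpos r t hr hrt).2).eventually_const_lt ht',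
      h.scale_tendsto.eventually_gt_atTop 0] with n hn han
    refine hn.trans_le (mul_le_mul_of_nonneg_left ?_ (Nat.cast_nonneg n))
    rw [← tailIntegral_map_smul han hφ]
    exact (tailIntegral_le_sectorTest_le (fun _ _ => measure_lt_top _ _) hφ hφ0 hr hrt).2
  · have hev := (hcont.eventually (gt_mem_nhds hb)).filter_mono
      (nhdsWithin_le_nhds (s := Set.Iio r))
    obtain ⟨t, ⟨ht, htr⟩, ht0⟩ := ((hev.and self_mem_nhdsWithin).and
      ((lt_mem_nhds hr).filter_mono nhdsWithin_le_nhds)).exists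
    replace htr : t < r := htr
    rw [← hα.tailIntegral_eq hφ ht0] at ht
    have ht' := (tailIntegral_le_sectorTest_le h.radon hφ hφ0 ht0 htr).2.trans_lt ht
    filter_upwards [(h.tendsto_sectorTest hH hφ (hpos t r ht0 htr).1
      (hpos t r ht0 htr).2).eventually_lt_const ht',
      h.scale_tendsto.eventually_gt_atTop 0] with n hn han
    refine lt_of_le_of_lt (mul_le_mul_of_nonneg_left ?_ (Nat.cast_nonneg n)) hn
    rw [← tailIntegral_map_smul han hφ]
    exact (tailIntegral_le_sectorTest_le (fun _ _ => measure_lt_top _ _) hφ hφ0 ht0 htr).1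

/-- A function squeezed between two convergent sequences on the gaps of a sequence tending to
infinity converges at infinity. -/
lemma tendsto_of_squeeze_on_gaps {a : ℕ → ℝ} (ha : Tendsto a atTop atTop) {f : ℝ → ℝ}
    {u v : ℕ → ℝ} {b : ℝ} (hu : Tendsto u atTop (𝓝 b)) (hv : Tendsto v atTop (𝓝 b))
    (hf : ∀ᶠ n in atTop, ∀ t, a n ≤ t → t < a (n + 1) → u n ≤ f t ∧ f t ≤ v n) :
    Tendsto f atTop (𝓝 b) := by
  -- The sequence need not be monotone. The first index from N on at which it exceeds t ends a gap
  -- containing t.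
  have key : ∀ p : ℕ → Prop, (∀ᶠ n in atTop, p n) →
      ∀ᶠ t in atTop, ∃ n, p n ∧ a n ≤ t ∧ t < a (n + 1) := by
    intro p hp
    obtain ⟨N, hN⟩ := eventually_atTop.1 hp
    filter_upwards [eventually_ge_atTop (a N)] with t ht
    have hex : ∃ k, t < a (N + k) := by
      obtain ⟨k, hk, hk'⟩ := ((ha.eventually_gt_atTop t).and (eventually_ge_atTop N)).exists
      exact ⟨k - N, by rwa [Nat.add_sub_cancel' hk']⟩
    classical
    obtain ⟨j, hj⟩ : ∃ j, Nat.find hex = j + 1 := Nat.exists_eq_succ_of_ne_zero fun h0 => by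
      have := Nat.find_spec hex
      rw [h0, add_zero] at this
      exact absurd ht (not_le.2 this)
    refine ⟨N + j, hN _ (Nat.le_add_right _ _), ?_, ?_⟩
    · exact not_lt.1 (Nat.find_min hex (m := j) (by omega))
    · have := Nat.find_spec hex
      rwa [hj, ← add_assoc] at this
  refine tendsto_order.2 ⟨fun x hx => ?_, fun x hx => ?_⟩
  · filter_upwards [key _ ((hu.eventually_const_lt hx).and hf)] with t ⟨n, ⟨h1, h2⟩, h3, h4⟩
    exact h1.trans_le (h2 t h3 h4).1
  · filter_upwards [key _ ((hv.eventually_lt_const hx).and hf)] with t ⟨n, ⟨h1, h2⟩, h3, h4⟩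
    exact (h2 t h3 h4).2.trans_lt h1

/-- If the unit tail were null, scaling would make every tail null, and μ would vanish off the
origin, which it does not charge. -/
lemma HasPowerLawTail.tail_one_pos (h : HasPowerLawTail P H a μ) (hα : IsTailIndex μ α) :
    0 < μ.real {x | 1 < ‖x‖} := by
  rw [measureReal_def, ENNReal.toReal_pos_iff]
  refine ⟨pos_iff_ne_zero.2 fun h0 => h.non_null ?_, h.radon 1 one_pos⟩
  have hr : ∀ r : ℝ, 0 < r → μ {x | r < ‖x‖} = 0 := by
    intro r hr
    have h1 := congrArg (fun m => m {x : E d | 1 < ‖x‖}) (hα.map_smul hr)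
    simp only [Measure.smul_apply, h0, smul_zero] at h1
    rw [Measure.map_apply (measurable_const_smul _) (measurableSet_lt_norm 1)] at h1
    convert h1 using 2
    ext x
    simp only [Set.mem_preimage, Set.mem_ofPred_eq, norm_smul, norm_inv, Real.norm_of_nonneg hr.le]
    rw [lt_inv_mul_iff₀ hr, mul_one]
  have hcov : (Set.univ : Set (E d)) ⊆ {0} ∪ ⋃ n : ℕ, {x | (1 : ℝ) / (n + 1) < ‖x‖} := by
    intro x _
    by_cases hx : x = 0
    · exact Or.inl hx
    · obtain ⟨n, hn⟩ := exists_nat_one_div_lt (norm_pos_iff.2 hx)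
      exact Or.inr (Set.mem_iUnion.2 ⟨n, hn⟩)
  rw [← Measure.measure_univ_eq_zero]
  refine measure_mono_null hcov (measure_union_null h.not_charge_zero ?_)
  exact measure_iUnion_null fun n => hr _ (by positivity)

/-- The tail of `H` is positive. -/
lemma HasPowerLawTail.tail_pos [IsProbabilityMeasure P] (h : HasPowerLawTail P H a μ) (hH : Measurable H)
    (hα : IsTailIndex μ α) (t : ℝ) : 0 < (P.map H).real {x | t < ‖x‖} := by
  have : IsProbabilityMeasure (P.map H) := Measure.isProbabilityMeasure_map hH.aemeasurable
  have h1 := h.tendsto_tailIntegral_seq hH hα (φ := fun _ => 1) continuous_const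
    (fun _ => zero_le_one) one_pos
  simp only [tailIntegral_one, mul_one, Real.one_rpow, one_mul] at h1
  obtain ⟨n, hn, hn'⟩ := ((h1.eventually_const_lt (h.tail_one_pos hα)).and
    (h.scale_tendsto.eventually_ge_atTop t)).exists
  have : 0 < (P.map H).real {x | a n < ‖x‖} := by
    by_contra hcon
    exact absurd hn (not_lt.2 (mul_nonpos_of_nonneg_of_nonpos (Nat.cast_nonneg n) (not_lt.1 hcon)))
  exact this.trans_le (measureReal_mono fun x hx => lt_of_le_of_lt hn' hx)

/-- Passage from the sequence a_n to a continuous level: numerator and denominator are both monotone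
in t, and the index shift across a gap costs only (n+1)/n → 1. -/
lemma HasPowerLawTail.tendsto_tailIntegral_of_nonneg [IsProbabilityMeasure P] (h : HasPowerLawTail P H a μ)
    (hH : Measurable H) (hα : IsTailIndex μ α) {φ : E d → ℝ} (hφ : Continuous φ)
    (hφ0 : ∀ x, 0 ≤ φ x) {r : ℝ} (hr : 0 < r) :
    Tendsto (fun t => tailIntegral (P.map H) φ (t * r) / (P.map H).real {x | t < ‖x‖}) atTop
      (𝓝 (r ^ (-α) * tailIntegral μ φ 1 / μ.real {x | 1 < ‖x‖})) := by
  have : IsProbabilityMeasure (P.map H) := Measure.isProbabilityMeasure_map hH.aemeasurable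
  have hs := h.tendsto_tailIntegral_seq hH hα hφ hφ0 hr
  have h1 := h.tendsto_tailIntegral_seq hH hα (φ := fun _ => 1) continuous_const
    (fun _ => zero_le_one) one_pos
  simp only [tailIntegral_one, mul_one, Real.one_rpow, one_mul] at h1
  have hc := (h.tail_one_pos hα).ne'
  have hsucc := tendsto_add_atTop_nat 1
  have hratio : Tendsto (fun n : ℕ => ((n + 1 : ℕ) : ℝ) / n) atTop (𝓝 1) := by
    have : Tendsto (fun n : ℕ => 1 + 1 / (n : ℝ)) atTop (𝓝 (1 + 0)) :=
      tendsto_const_nhds.add tendsto_one_div_atTop_nhds_zero_nat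
    rw [add_zero] at this
    refine this.congr' ?_
    filter_upwards [eventually_gt_atTop 0] with n hn
    have : (n : ℝ) ≠ 0 := by positivity
    push_cast
    field_simp
  -- The upper bound takes the numerator at a_n and the denominator at a_{n+1}; the lower bound
  -- interchanges them.
  have hv := (hs.div (h1.comp hsucc) hc).mul hratio
  have hu := ((hs.comp hsucc).div h1 hc).div hratio one_ne_zero
  rw [mul_one] at hv
  rw [div_one] at hu
  refine tendsto_of_squeeze_on_gaps h.scale_tendsto hu hv ?_
  have hfin : ∀ r : ℝ, (P.map H) {x | r < ‖x‖} < ⊤ := fun _ => measure_lt_top _ _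
  filter_upwards [eventually_gt_atTop 0, h.scale_tendsto.eventually_gt_atTop 0] with n hn han t h3 h4
  have hn' : (0 : ℝ) < n := by positivity
  have hn1 : (0 : ℝ) < (n + 1 : ℕ) := by positivity
  have hG1 := h.tail_pos hH hα (a n)
  have hG2 := h.tail_pos hH hα (a (n + 1))
  have hG3 := h.tail_pos hH hα t
  simp only [Pi.div_apply, Function.comp_apply]
  constructor
  · calc _ = tailIntegral (P.map H) φ (a (n + 1) * r) / (P.map H).real {x | a n < ‖x‖} := by
          field_simp
      _ ≤ _ := by
          refine div_le_div₀ (tailIntegral_nonneg hφ0) ?_ hG3 ?_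
          · exact tailIntegral_anti (hfin _) hφ hφ0 (by nlinarith) (by gcongr)
          · exact measureReal_mono fun x hx => lt_of_le_of_lt h3 hx
  · calc _ ≤ tailIntegral (P.map H) φ (a n * r) / (P.map H).real {x | a (n + 1) < ‖x‖} := by
          refine div_le_div₀ (tailIntegral_nonneg hφ0) ?_ hG2 ?_
          · exact tailIntegral_anti (hfin _) hφ hφ0 (by positivity) (by gcongr)
          · exact measureReal_mono fun x hx => lt_trans h4 hx
      _ = _ := by
          field_simp

/-- Regular variation of the tails of `H`, weighted by a function of the direction. -/
lemma HasPowerLawTail.tendsto_tailIntegral [IsProbabilityMeasure P] (h : HasPowerLawTail P H a μ)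
    (hH : Measurable H) (hα : IsTailIndex μ α) {φ : E d → ℝ} (hφ : Continuous φ) {r : ℝ}
    (hr : 0 < r) :
    Tendsto (fun t => tailIntegral (P.map H) φ (t * r) / (P.map H).real {x | t < ‖x‖}) atTop
      (𝓝 (r ^ (-α) * tailIntegral μ φ 1 / μ.real {x | 1 < ‖x‖})) := by
  have : IsProbabilityMeasure (P.map H) := Measure.isProbabilityMeasure_map hH.aemeasurable
  have hp : Continuous fun x => max (φ x) 0 := by fun_prop
  have hn : Continuous fun x => max (-φ x) 0 := by fun_prop
  -- Monotonicity required a sign, so positive and negative parts are treated separately.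
  have heq : φ = fun x => max (φ x) 0 - max (-φ x) 0 := by
    ext x
    exact (max_zero_sub_max_neg_zero_eq_self (φ x)).symm
  have h1 := (h.tendsto_tailIntegral_of_nonneg hH hα hp (fun _ => le_max_right _ _) hr).sub
    (h.tendsto_tailIntegral_of_nonneg hH hα hn (fun _ => le_max_right _ _) hr)
  rw [← sub_div, ← mul_sub, ← tailIntegral_sub (h.radon 1 one_pos) hp hn zero_le_one, ← heq] at h1
  refine h1.congr' ?_
  filter_upwards [eventually_gt_atTop 0] with t ht
  rw [← sub_div, ← tailIntegral_sub (measure_lt_top _ _) hp hn (by positivity), ← heq]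

end Vague

/-! ### Potter bounds -/

section Potter

variable {G : ℝ → ℝ} {α : ℝ}

/-- Potter bound below the reference level, for every exponent above the tail index. -/
lemma exists_potter_lower (hG : Antitone G) (hpos : ∀ t, 0 < G t) (hone : ∀ t, G t ≤ 1)
    (hlim : Tendsto (fun t => G (t * 2) / G t) atTop (𝓝 (2 ^ (-α)))) {q : ℝ} (hq0 : 0 < q)
    (hq : α < q) :
    ∃ C t₀, 0 < C ∧ 0 < t₀ ∧ ∀ t, t₀ ≤ t → ∀ s, 0 < s → s ≤ 1 →
      G (t * s) ≤ C * s ^ (-q) * G t := by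
  -- Because q > α, halving a large level multiplies the tail by at most 2^q; iteration over dyadic
  -- scales gives the power bound.
  have hlt : (2 : ℝ) ^ (-q) < 2 ^ (-α) :=
    Real.rpow_lt_rpow_of_exponent_lt one_lt_two (by linarith)
  obtain ⟨t₁, ht₁⟩ := eventually_atTop.1 (hlim.eventually_const_lt hlt)
  set t₀ := max t₁ 1
  have ht₀ : 0 < t₀ := lt_of_lt_of_le one_pos (le_max_right _ _)
  have hstep : ∀ u, t₀ ≤ u → G u ≤ 2 ^ q * G (u * 2) := by
    intro u hu
    have := ht₁ u ((le_max_left _ _).trans hu)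
    rw [lt_div_iff₀ (hpos u), Real.rpow_neg two_pos.le, inv_mul_lt_iff₀ (by positivity)] at this
    exact this.le
  have hiter : ∀ k : ℕ, ∀ u, t₀ ≤ u → G u ≤ (2 ^ q) ^ k * G (u * 2 ^ k) := by
    intro k
    induction k with
    | zero => intro u _; simp
    | succ k ih =>
      intro u hu
      refine (ih u hu).trans ?_
      have hle : (2 ^ q) ^ k * G (u * 2 ^ k) ≤ (2 ^ q) ^ k * (2 ^ q * G (u * 2 ^ k * 2)) := by
        refine mul_le_mul_of_nonneg_left (hstep _ ?_) (by positivity)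
        exact hu.trans (le_mul_of_one_le_right (ht₀.le.trans hu) (one_le_pow₀ one_le_two))
      refine hle.trans (le_of_eq ?_)
      rw [pow_succ, pow_succ, ← mul_assoc, ← mul_assoc]
  have hmain : ∀ u t, t₀ ≤ u → u ≤ t → G u ≤ 2 ^ q * (t / u) ^ q * G t := by
    intro u t hu hut
    have hu0 := ht₀.trans_le hu
    obtain ⟨k, hk1, hk2⟩ := exists_nat_pow_near ((one_le_div hu0).2 hut) one_lt_two
    refine (hiter (k + 1) u hu).trans ?_
    have h1 : G (u * 2 ^ (k + 1)) ≤ G t := by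
      refine hG ?_
      rw [div_lt_iff₀ hu0] at hk2
      linarith
    have h2 : ((2 : ℝ) ^ q) ^ (k + 1) ≤ 2 ^ q * (t / u) ^ q := by
      rw [pow_succ, mul_comm, ← Real.rpow_natCast, ← Real.rpow_mul two_pos.le, mul_comm q,
        Real.rpow_mul two_pos.le, Real.rpow_natCast]
      gcongr
    exact mul_le_mul h2 h1 (hpos _).le (by have := ht₀.trans_le (hu.trans hut); positivity)
  have hC1 : 1 ≤ 1 / G t₀ := (one_le_div (hpos _)).2 (hone _)
  refine ⟨1 / G t₀ * 2 ^ q, t₀, by have := hpos t₀; positivity, ht₀, fun t ht s hs hs1 => ?_⟩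
  have ht0 := ht₀.trans_le ht
  have hGt := hpos t
  have hGt₀ := hpos t₀
  by_cases hts : t₀ ≤ t * s
  · refine (hmain (t * s) t hts (by nlinarith)).trans ?_
    have : t / (t * s) = s⁻¹ := by field_simp
    rw [this, Real.inv_rpow hs.le, ← Real.rpow_neg hs.le]
    gcongr
    exact le_mul_of_one_le_left (by positivity) hC1
  -- Below the threshold t₀ the doubling estimate is unavailable; G ≤ 1 is used there, together with
  -- the bound between t₀ and t and t/t₀ ≤ 1/s. This is the origin of the constant 1/G(t₀).
  · push Not at hts
    calc G (t * s) ≤ 1 / G t₀ * G t₀ := by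
          rw [one_div, inv_mul_cancel₀ (hpos _).ne']
          exact hone _
      _ ≤ 1 / G t₀ * (2 ^ q * (t / t₀) ^ q * G t) := by
          gcongr
          exact hmain t₀ t le_rfl ht
      _ ≤ 1 / G t₀ * (2 ^ q * s ^ (-q) * G t) := by
          rw [Real.rpow_neg hs.le, ← Real.inv_rpow hs.le]
          gcongr
          rw [div_le_iff₀ ht₀, inv_mul_eq_div, le_div_iff₀ hs]
          exact hts.le
      _ = _ := by ring

/-- Potter bound above the reference level, for every exponent below the tail index. -/
lemma exists_potter_upper (hG : Antitone G) (hpos : ∀ t, 0 < G t)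
    (hlim : Tendsto (fun t => G (t * 2) / G t) atTop (𝓝 (2 ^ (-α)))) {q : ℝ} (hq0 : 0 < q)
    (hq : q < α) :
    ∃ C t₀, 0 < C ∧ 0 < t₀ ∧ ∀ t, t₀ ≤ t → ∀ s, 1 ≤ s → G (t * s) ≤ C * s ^ (-q) * G t := by
  have hlt : (2 : ℝ) ^ (-α) < 2 ^ (-q) :=
    Real.rpow_lt_rpow_of_exponent_lt one_lt_two (by linarith)
  obtain ⟨t₁, ht₁⟩ := eventually_atTop.1 (hlim.eventually_lt_const hlt)
  set t₀ := max t₁ 1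
  have ht₀ : 0 < t₀ := lt_of_lt_of_le one_pos (le_max_right _ _)
  have hstep : ∀ u, t₀ ≤ u → G (u * 2) ≤ 2 ^ (-q) * G u := by
    intro u hu
    have := ht₁ u ((le_max_left _ _).trans hu)
    rw [div_lt_iff₀ (hpos u)] at this
    exact this.le
  have hiter : ∀ k : ℕ, ∀ u, t₀ ≤ u → G (u * 2 ^ k) ≤ (2 ^ (-q)) ^ k * G u := by
    intro k
    induction k with
    | zero => intro u _; simp
    | succ k ih =>
      intro u hu
      have h1 : u * 2 ^ (k + 1) = u * 2 ^ k * 2 := by ring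
      have h2 : ((2 : ℝ) ^ (-q)) ^ (k + 1) * G u = 2 ^ (-q) * ((2 ^ (-q)) ^ k * G u) := by ring
      rw [h1, h2]
      refine (hstep _ ?_).trans (mul_le_mul_of_nonneg_left (ih u hu) (by positivity))
      exact hu.trans (le_mul_of_one_le_right (ht₀.le.trans hu) (one_le_pow₀ one_le_two))
  refine ⟨2 ^ q, t₀, by positivity, ht₀, fun t ht s hs => ?_⟩
  have ht0 := ht₀.trans_le ht
  have hGt := hpos t
  -- Rounding s down to a power of 2 costs at most the factor 2^q.
  obtain ⟨k, hk1, hk2⟩ := exists_nat_pow_near hs one_lt_two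
  calc G (t * s) ≤ G (t * 2 ^ k) := hG (by gcongr)
    _ ≤ (2 ^ (-q)) ^ k * G t := hiter k t ht
    _ ≤ 2 ^ q * s ^ (-q) * G t := by
      gcongr
      have h1 : ((2 : ℝ) ^ (-q)) ^ k = 2 ^ q * (2 ^ (k + 1)) ^ (-q) := by
        rw [← Real.rpow_natCast, ← Real.rpow_mul two_pos.le, ← Real.rpow_natCast,
          ← Real.rpow_mul two_pos.le, ← Real.rpow_add two_pos]
        congr 1
        push_cast
        ring
      rw [h1]
      refine mul_le_mul_of_nonneg_left ?_ (by positivity)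
      exact Real.rpow_le_rpow_of_nonpos (by linarith) hk2.le (by linarith)

end Potter

end TruncatedTails

namespace TruncatedTails

/-! ### Polar disintegration of integrals -/

section Polar

variable {d : ℕ} {m : Measure (E d)} {μ : Measure (E d)} {α b K : ℝ}

/-- The limit measure may be infinite near the origin, yet Fubini applies to it because its tails
exhaust the punctured space. -/
lemma sigmaFinite_of_tail_lt_top (hm : ∀ r, 0 < r → m {x : E d | r < ‖x‖} < ⊤)
    (h0 : m {0} = 0) : SigmaFinite m := by
  refine ⟨⟨⟨fun n : ℕ => {0} ∪ {x | (1 : ℝ) / (n + 1) < ‖x‖}, fun _ => trivial, fun n => ?_, ?_⟩⟩⟩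
  · refine (measure_union_le _ _).trans_lt ?_
    rw [h0, zero_add]
    exact hm _ (by positivity)
  · refine Set.eq_univ_of_forall fun x => Set.mem_iUnion.2 ?_
    by_cases hx : x = 0
    · exact ⟨0, Or.inl hx⟩
    · obtain ⟨n, hn⟩ := exists_nat_one_div_lt (norm_pos_iff.2 hx)
      exact ⟨n, Or.inr hn⟩

lemma measurable_uncurry_direction {ψ : ℝ → E d → ℝ} (hψ : Continuous (Function.uncurry ψ)) :
    Measurable (fun p : ℝ × E d => ψ p.1 (‖p.2‖⁻¹ • p.2)) :=
  hψ.measurable.comp (measurable_fst.prodMk (measurable_direction.comp measurable_snd))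

/-- Polar form of the integral over the unit ball of a function given radially by a density. -/
theorem integral_ball_eq [SFinite m] (hm : ∀ r, 0 < r → m {x : E d | r < ‖x‖} < ⊤)
    {ψ : ℝ → E d → ℝ} (hψ : Continuous (Function.uncurry ψ))
    (hK : ∀ s, 0 < s → s ≤ 1 → ∀ x, ‖x‖ = 1 → |ψ s x| ≤ K * s ^ b)
    (hint : IntegrableOn (fun s => s ^ b * m.real {x | s < ‖x‖}) (Set.Ioc 0 1)) :
    IntegrableOn (fun x => ∫ s in (0 : ℝ)..‖x‖, ψ s (‖x‖⁻¹ • x)) (Metric.closedBall 0 1) m ∧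
    IntegrableOn (fun s => tailIntegral m (ψ s) s - tailIntegral m (ψ s) 1) (Set.Ioc 0 1) ∧
    ∫ x in Metric.closedBall 0 1, (∫ s in (0 : ℝ)..‖x‖, ψ s (‖x‖⁻¹ • x)) ∂m =
      ∫ s in Set.Ioc (0 : ℝ) 1, (tailIntegral m (ψ s) s - tailIntegral m (ψ s) 1) := by
  -- Fubini on this region: integrating over s first gives the radial integral on the ball,
  -- integrating over x first gives the difference of tail integrals.
  set S : Set (ℝ × E d) := {p | p.1 < ‖p.2‖ ∧ ‖p.2‖ ≤ 1} with hS
  have hSm : MeasurableSet S :=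
    (measurableSet_lt measurable_fst measurable_snd.norm).inter
      (measurableSet_le measurable_snd.norm measurable_const)
  set f : ℝ × E d → ℝ := S.indicator fun p => ψ p.1 (‖p.2‖⁻¹ • p.2) with hf
  have hfm : Measurable f := (measurable_uncurry_direction hψ).indicator hSm
  have hψs : ∀ s, Continuous (ψ s) := fun s => hψ.comp (Continuous.prodMk_right s)
  have hfs : ∀ s, 0 < s → s ≤ 1 → ∀ x, |f (s, x)| ≤
      {x : E d | s < ‖x‖}.indicator (fun _ => K * s ^ b) x := by
    intro s hs hs1 x
    by_cases hx : s < ‖x‖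
    · rw [Set.indicator_of_mem (by exact hx)]
      have hb := hK s hs hs1 _ (norm_direction_of_lt hs.le hx)
      by_cases hx' : (s, x) ∈ S
      · simpa only [hf, Set.indicator_of_mem hx'] using hb
      · simpa only [hf, Set.indicator_of_notMem hx', abs_zero] using (abs_nonneg _).trans hb
    · have hx' : (s, x) ∉ S := fun h => hx h.1
      simp only [hf, Set.indicator_of_notMem hx', abs_zero]
      rw [Set.indicator_of_notMem (by exact hx)]
  have hind : ∀ s, 0 < s → Integrable ({x : E d | s < ‖x‖}.indicator (fun _ => K * s ^ b)) m :=
    fun s hs => (integrable_indicator_iff (measurableSet_lt_norm s)).2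
      (integrableOn_const (hm s hs).ne)
  have hfint : ∀ s, 0 < s → s ≤ 1 → Integrable (fun x => f (s, x)) m := fun s hs hs1 =>
    (hind s hs).mono' (hfm.comp measurable_prodMk_left).aestronglyMeasurable
      (Eventually.of_forall fun x => hfs s hs hs1 x)
  have hprod : Integrable f ((volume.restrict (Set.Ioc (0 : ℝ) 1)).prod m) := by
    rw [integrable_prod_iff hfm.aestronglyMeasurable]
    constructor
    · rw [ae_restrict_iff' measurableSet_Ioc]
      exact Eventually.of_forall fun s hs => hfint s hs.1 hs.2
    · refine (hint.const_mul K).mono' ?_ ?_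
      · exact hfm.norm.stronglyMeasurable.integral_prod_right.aestronglyMeasurable
      · rw [ae_restrict_iff' measurableSet_Ioc]
        refine Eventually.of_forall fun s hs => ?_
        rw [Real.norm_of_nonneg (integral_nonneg fun _ => norm_nonneg _)]
        refine (integral_mono (hfint s hs.1 hs.2).norm (hind s hs.1)
          (fun x => hfs s hs.1 hs.2 x)).trans (le_of_eq ?_)
        rw [integral_indicator_const _ (measurableSet_lt_norm s), smul_eq_mul]
        ring
  have hleft : ∀ s ∈ Set.Ioc (0 : ℝ) 1,
      ∫ x, f (s, x) ∂m = tailIntegral m (ψ s) s - tailIntegral m (ψ s) 1 := by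
    intro s hs
    have hset : (fun x => f (s, x)) =
        ({x : E d | s < ‖x‖} \ {x | 1 < ‖x‖}).indicator (fun x => ψ s (‖x‖⁻¹ • x)) := by
      ext x
      by_cases hx : (s, x) ∈ S
      · rw [Set.indicator_of_mem (by exact ⟨hx.1, not_lt.2 hx.2⟩)]
        simp only [hf, Set.indicator_of_mem hx]
      · rw [Set.indicator_of_notMem (by exact fun h => hx ⟨h.1, not_lt.1 h.2⟩)]
        simp only [hf, Set.indicator_of_notMem hx]
    rw [hset, integral_indicator ((measurableSet_lt_norm s).diff (measurableSet_lt_norm 1)),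
      setIntegral_sdiff (measurableSet_lt_norm 1)
        (integrableOn_direction (hm s hs.1) (hψs s) hs.1.le)]
    · rfl
    · exact fun x hx => lt_of_le_of_lt hs.2 hx
  have hright : ∀ x, ∫ s in Set.Ioc (0 : ℝ) 1, f (s, x) =
      (Metric.closedBall (0 : E d) 1).indicator
        (fun x => ∫ s in (0 : ℝ)..‖x‖, ψ s (‖x‖⁻¹ • x)) x := by
    intro x
    by_cases hx : ‖x‖ ≤ 1
    · have hfx : (fun s => f (s, x)) = (Set.Iio ‖x‖).indicator (fun s => ψ s (‖x‖⁻¹ • x)) := by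
        ext s
        by_cases hs : s < ‖x‖
        · have : (s, x) ∈ S := ⟨hs, hx⟩
          simp only [hf, Set.indicator_of_mem this]
          rw [Set.indicator_of_mem (by exact hs)]
        · have : (s, x) ∉ S := fun h => hs h.1
          simp only [hf, Set.indicator_of_notMem this]
          rw [Set.indicator_of_notMem (by exact hs)]
      rw [Set.indicator_of_mem (by simpa using hx), hfx, setIntegral_indicator measurableSet_Iio,
        intervalIntegral.integral_of_le (norm_nonneg x), integral_Ioc_eq_integral_Ioo]
      congr 2
      ext s
      simp only [Set.mem_inter_iff, Set.mem_Ioc, Set.mem_Iio, Set.mem_Ioo]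
      constructor
      · rintro ⟨⟨h1, -⟩, h2⟩
        exact ⟨h1, h2⟩
      · rintro ⟨h1, h2⟩
        exact ⟨⟨h1, h2.le.trans hx⟩, h2⟩
    · rw [Set.indicator_of_notMem (by simpa using hx)]
      have : ∀ s, f (s, x) = 0 := fun s => Set.indicator_of_notMem (fun h => hx h.2) _
      simp [this]
  refine ⟨?_, ?_, ?_⟩
  · rw [← integrable_indicator_iff Metric.isClosed_closedBall.measurableSet]
    exact hprod.integral_prod_right.congr (Eventually.of_forall hright)
  · refine hprod.integral_prod_left.congr ?_
    rw [EventuallyEq, ae_restrict_iff' measurableSet_Ioc]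
    exact Eventually.of_forall hleft
  · rw [← setIntegral_congr_fun measurableSet_Ioc hleft,
      ← integral_indicator Metric.isClosed_closedBall.measurableSet]
    rw [integral_integral_swap (f := fun s x => f (s, x)) hprod]
    exact integral_congr_ae (Eventually.of_forall fun x => (hright x).symm)

/-- Polar form of the integral of a homogeneous function outside the unit ball. -/
theorem integral_tail_eq [IsFiniteMeasure m] {φ : E d → ℝ} (hφ : Continuous φ)
    (hint : IntegrableOn (fun s => m.real {x | s < ‖x‖}) (Set.Ioi 1)) :
    ∫ x in {x : E d | 1 < ‖x‖}, ‖x‖ * φ (‖x‖⁻¹ • x) ∂m =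
      tailIntegral m φ 1 + ∫ s in Set.Ioi (1 : ℝ), tailIntegral m φ s := by
  obtain ⟨K, hK0, hK⟩ := exists_bound_on_sphere hφ
  set S : Set (ℝ × E d) := {p | p.1 < ‖p.2‖} with hS
  have hSm : MeasurableSet S := measurableSet_lt measurable_fst measurable_snd.norm
  set f : ℝ × E d → ℝ := S.indicator fun p => φ (‖p.2‖⁻¹ • p.2) with hf
  have hfm : Measurable f :=
    (hφ.measurable.comp (measurable_direction.comp measurable_snd)).indicator hSm
  have hsec : ∀ s, (fun x => f (s, x)) =
      {x : E d | s < ‖x‖}.indicator (fun x => φ (‖x‖⁻¹ • x)) := fun s => rfl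
  have hprod : Integrable f ((volume.restrict (Set.Ioi (1 : ℝ))).prod m) := by
    rw [integrable_prod_iff hfm.aestronglyMeasurable]
    have hfint : ∀ s, 1 < s → Integrable (fun x => f (s, x)) m := fun s hs => by
      rw [hsec, integrable_indicator_iff (measurableSet_lt_norm s)]
      exact integrableOn_direction (measure_lt_top _ _) hφ (by linarith)
    constructor
    · rw [ae_restrict_iff' measurableSet_Ioi]
      exact Eventually.of_forall fun s hs => hfint s hs
    · refine (hint.const_mul K).mono' ?_ ?_
      · exact hfm.norm.stronglyMeasurable.integral_prod_right.aestronglyMeasurable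
      · rw [ae_restrict_iff' measurableSet_Ioi]
        refine Eventually.of_forall fun s hs => ?_
        have hs0 : (0 : ℝ) ≤ s := le_trans zero_le_one (le_of_lt hs)
        rw [Real.norm_of_nonneg (integral_nonneg fun _ => norm_nonneg _)]
        have hI : Integrable ({x : E d | s < ‖x‖}.indicator (fun _ => K)) m :=
          (integrable_const K).indicator (measurableSet_lt_norm s)
        refine (integral_mono (hfint s hs).norm hI (fun x => ?_)).trans (le_of_eq ?_)
        · by_cases hx : s < ‖x‖
          · rw [Set.indicator_of_mem (by exact hx)]
            have hx' : (s, x) ∈ S := hx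
            simp only [hf, Set.indicator_of_mem hx']
            exact hK _ (norm_direction_of_lt hs0 hx)
          · rw [Set.indicator_of_notMem (by exact hx)]
            have hx' : (s, x) ∉ S := hx
            simp only [hf, Set.indicator_of_notMem hx', norm_zero, le_refl]
        · rw [integral_indicator_const _ (measurableSet_lt_norm s), smul_eq_mul, mul_comm]
  have hleft : ∀ s, ∫ x, f (s, x) ∂m = tailIntegral m φ s := fun s => by
    rw [hsec, integral_indicator (measurableSet_lt_norm s), tailIntegral]
  -- Levels between 1 and ‖x‖ account for ‖x‖ - 1; the missing unit of ‖x‖ is the separate term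
  -- `tailIntegral m φ 1`.
  have hright : ∀ x, ∫ s in Set.Ioi (1 : ℝ), f (s, x) =
      {x : E d | 1 < ‖x‖}.indicator (fun x => (‖x‖ - 1) * φ (‖x‖⁻¹ • x)) x := by
    intro x
    have hfx : (fun s => f (s, x)) = (Set.Iio ‖x‖).indicator (fun _ => φ (‖x‖⁻¹ • x)) := rfl
    rw [hfx, setIntegral_indicator measurableSet_Iio, Set.Ioi_inter_Iio, setIntegral_const,
      smul_eq_mul, Real.volume_real_Ioo]
    by_cases hx : 1 < ‖x‖
    · rw [Set.indicator_of_mem (by exact hx), max_eq_left (by linarith)]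
    · rw [Set.indicator_of_notMem (by exact hx), max_eq_right (by linarith), zero_mul]
  have hrad : IntegrableOn (fun x => (‖x‖ - 1) * φ (‖x‖⁻¹ • x)) {x : E d | 1 < ‖x‖} m := by
    rw [← integrable_indicator_iff (measurableSet_lt_norm 1)]
    exact hprod.integral_prod_right.congr (Eventually.of_forall hright)
  have hsplit : ∀ x : E d, ‖x‖ * φ (‖x‖⁻¹ • x) =
      φ (‖x‖⁻¹ • x) + (‖x‖ - 1) * φ (‖x‖⁻¹ • x) := fun x => by ring
  simp only [hsplit]
  rw [integral_add (integrableOn_direction (measure_lt_top _ _) hφ zero_le_one) hrad, tailIntegral]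
  congr 1
  rw [← integral_indicator (measurableSet_lt_norm 1),
    ← integral_congr_ae (Eventually.of_forall hright),
    ← integral_integral_swap (f := fun s x => f (s, x)) hprod]
  simp only [hleft]

end Polar

/-! ### Truncated moments at large scales -/

section Asymptotics

variable {Ω : Type*} [MeasurableSpace Ω] {P : Measure Ω} {d : ℕ} {H : Ω → E d} {a : ℕ → ℝ}
  {μ : Measure (E d)} {α b K : ℝ}

lemma map_smul_real_lt_norm {ρ : Measure (E d)} {t : ℝ} (ht : 0 < t) (s : ℝ) :
    (ρ.map (fun x => t⁻¹ • x)).real {x | s < ‖x‖} = ρ.real {x | t * s < ‖x‖} := by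
  rw [← tailIntegral_one, tailIntegral_map_smul ht continuous_const, tailIntegral_one]

lemma antitone_real_lt_norm (ρ : Measure (E d)) [IsFiniteMeasure ρ] :
    Antitone (fun t => ρ.real {x : E d | t < ‖x‖}) := fun _ _ hst =>
  measureReal_mono fun _ hx => lt_of_le_of_lt hst hx

lemma HasPowerLawTail.tendsto_tail_two [IsProbabilityMeasure P] (h : HasPowerLawTail P H a μ)
    (hH : Measurable H) (hα : IsTailIndex μ α) :
    Tendsto (fun t => (P.map H).real {x | t * 2 < ‖x‖} / (P.map H).real {x | t < ‖x‖}) atTop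
      (𝓝 (2 ^ (-α))) := by
  have := h.tendsto_tailIntegral hH hα (φ := fun _ => 1) continuous_const two_pos
  simp only [tailIntegral_one] at this
  rwa [mul_div_assoc, div_self (h.tail_one_pos hα).ne', mul_one] at this

lemma IsTailIndex.real_lt_norm (hα : IsTailIndex μ α) {s : ℝ} (hs : 0 < s) :
    μ.real {x | s < ‖x‖} = s ^ (-α) * μ.real {x | 1 < ‖x‖} := by
  rw [← tailIntegral_one, hα.tailIntegral_eq continuous_const hs, tailIntegral_one]

/-- By scaling the integrand is a multiple of s^{b-α}, whose exponent exceeds -1. -/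
lemma IsTailIndex.integrableOn_rpow_mul (hα : IsTailIndex μ α) (hαb : α < 1 + b) :
    IntegrableOn (fun s => s ^ b * μ.real {x | s < ‖x‖}) (Set.Ioc 0 1) := by
  have h1 : IntegrableOn (fun s : ℝ => s ^ (b - α) * μ.real {x | 1 < ‖x‖}) (Set.Ioc 0 1) := by
    rw [← intervalIntegrable_iff_integrableOn_Ioc_of_le zero_le_one]
    exact (intervalIntegral.intervalIntegrable_rpow' (by linarith)).mul_const _
  refine h1.congr_fun (fun s hs => ?_) measurableSet_Ioc
  simp only [hα.real_lt_norm hs.1, sub_eq_add_neg, Real.rpow_add hs.1, mul_assoc]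

lemma integrableOn_rpow_mul_of_isFiniteMeasure (ρ : Measure (E d)) [IsFiniteMeasure ρ]
    (hb : 0 ≤ b) : IntegrableOn (fun s => s ^ b * ρ.real {x : E d | s < ‖x‖}) (Set.Ioc 0 1) := by
  refine IntegrableOn.of_bound measure_Ioc_lt_top ?_ (ρ.real Set.univ) ?_
  · exact ((Real.continuous_rpow_const hb).measurable.mul
      (antitone_real_lt_norm ρ).measurable).aestronglyMeasurable
  · rw [ae_restrict_iff' measurableSet_Ioc]
    refine Eventually.of_forall fun s hs => ?_
    have h1 : s ^ b ≤ 1 := Real.rpow_le_one hs.1.le hs.2 hb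
    have h2 : 0 ≤ s ^ b := Real.rpow_nonneg hs.1.le b
    have h3 : ρ.real {x : E d | s < ‖x‖} ≤ ρ.real Set.univ := measureReal_mono (Set.subset_univ _)
    rw [Real.norm_of_nonneg (mul_nonneg h2 measureReal_nonneg)]
    calc _ ≤ 1 * ρ.real Set.univ := mul_le_mul h1 h3 measureReal_nonneg zero_le_one
      _ = _ := one_mul _

/-- Asymptotics of truncated moments of `H`, for functions small enough at the origin. -/
theorem HasPowerLawTail.tendsto_integral_ball [IsProbabilityMeasure P]
    (h : HasPowerLawTail P H a μ) (hH : Measurable H) (hα : IsTailIndex μ α) (hb : 0 ≤ b)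
    (hαb : α < 1 + b) {ψ : ℝ → E d → ℝ} (hψ : Continuous (Function.uncurry ψ))
    (hK : ∀ s, 0 < s → s ≤ 1 → ∀ x, ‖x‖ = 1 → |ψ s x| ≤ K * s ^ b) :
    Tendsto (fun t => (∫ x in Metric.closedBall 0 1, (∫ s in (0 : ℝ)..‖x‖, ψ s (‖x‖⁻¹ • x))
        ∂((P.map H).map (fun x => t⁻¹ • x))) / (P.map H).real {x | t < ‖x‖}) atTop
      (𝓝 ((∫ x in Metric.closedBall 0 1, (∫ s in (0 : ℝ)..‖x‖, ψ s (‖x‖⁻¹ • x)) ∂μ) /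
        μ.real {x | 1 < ‖x‖})) := by
  have hprob : IsProbabilityMeasure (P.map H) := Measure.isProbabilityMeasure_map hH.aemeasurable
  have hσ : SigmaFinite μ := sigmaFinite_of_tail_lt_top h.radon h.not_charge_zero
  have hψs : ∀ s, Continuous (ψ s) := fun s => hψ.comp (Continuous.prodMk_right s)
  set G : ℝ → ℝ := fun t => (P.map H).real {x | t < ‖x‖} with hG
  have hGpos : ∀ t, 0 < G t := h.tail_pos hH hα
  have hGanti : Antitone G := antitone_real_lt_norm _
  -- q > α is what the Potter bound needs, and q < 1 + b makes the dominating function s^{b-q}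
  -- integrable at 0.
  obtain ⟨q, hq1, hq2⟩ := exists_between hαb
  obtain ⟨C, t₀, hC, ht₀, hpot⟩ := exists_potter_lower hGanti hGpos (fun t => measureReal_le_one)
    (h.tendsto_tail_two hH hα) (hα.1.trans hq1) hq1
  have key : ∀ t : ℝ, 0 < t → _ := fun t _ =>
    integral_ball_eq (m := (P.map H).map (fun x => t⁻¹ • x)) (fun _ _ => measure_lt_top _ _) hψ hK
      (integrableOn_rpow_mul_of_isFiniteMeasure _ hb)
  rw [(integral_ball_eq h.radon hψ hK (hα.integrableOn_rpow_mul hαb)).2.2, ← integral_div]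
  have hmain : Tendsto (fun t => ∫ s in Set.Ioc (0 : ℝ) 1,
      (tailIntegral ((P.map H).map (fun x => t⁻¹ • x)) (ψ s) s -
        tailIntegral ((P.map H).map (fun x => t⁻¹ • x)) (ψ s) 1) / G t) atTop
      (𝓝 (∫ s in Set.Ioc (0 : ℝ) 1, (tailIntegral μ (ψ s) s - tailIntegral μ (ψ s) 1) /
        μ.real {x | 1 < ‖x‖})) := by
    refine tendsto_integral_filter_of_dominated_convergence (fun s => 2 * (K * C) * s ^ (b - q))
      ?_ ?_ ?_ ?_
    · filter_upwards [eventually_gt_atTop 0] with t ht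
      exact ((key t ht).2.1.div_const _).aestronglyMeasurable
    · filter_upwards [eventually_ge_atTop t₀] with t ht
      have ht0 := ht₀.trans_le ht
      rw [ae_restrict_iff' measurableSet_Ioc]
      refine Eventually.of_forall fun s hs => ?_
      have hGs : G (t * s) ≤ C * s ^ (-q) * G t := hpot t ht s hs.1 hs.2
      have hGt : G t ≤ G (t * s) := hGanti (by nlinarith [hs.1, hs.2])
      rw [tailIntegral_map_smul ht0 (hψs s), tailIntegral_map_smul ht0 (hψs s), mul_one,
        norm_div, Real.norm_of_nonneg (hGpos t).le, div_le_iff₀ (hGpos t), Real.norm_eq_abs]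
      have h1 := abs_tailIntegral_le (m := P.map H) (r := t * s) (measure_lt_top _ _)
        (mul_nonneg ht0.le hs.1.le) (hK s hs.1 hs.2)
      have h2 := abs_tailIntegral_le (m := P.map H) (r := t) (measure_lt_top _ _) ht0.le
        (hK s hs.1 hs.2)
      -- No sign is assumed for K; the bound on an absolute value and the positivity of the tail
      -- force it.
      have hKs : 0 ≤ K * s ^ b := by
        by_contra hneg
        have := (abs_nonneg _).trans h2
        exact absurd this (not_le.2 (mul_neg_of_neg_of_pos (not_le.1 hneg) (hGpos t)))
      calc _ ≤ |tailIntegral (P.map H) (ψ s) (t * s)| + |tailIntegral (P.map H) (ψ s) t| :=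
            abs_sub _ _
        _ ≤ K * s ^ b * G (t * s) + K * s ^ b * G t := add_le_add h1 h2
        _ ≤ K * s ^ b * (C * s ^ (-q) * G t) + K * s ^ b * (C * s ^ (-q) * G t) := by
            gcongr
            exact hGt.trans hGs
        _ = 2 * (K * C) * s ^ (b - q) * G t := by
            rw [sub_eq_add_neg, Real.rpow_add hs.1]
            ring
    · change IntegrableOn _ _ _
      rw [← intervalIntegrable_iff_integrableOn_Ioc_of_le zero_le_one]
      exact (intervalIntegral.intervalIntegrable_rpow' (by linarith)).const_mul _
    · rw [ae_restrict_iff' measurableSet_Ioc]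
      refine Eventually.of_forall fun s hs => ?_
      have h1 := h.tendsto_tailIntegral hH hα (hψs s) hs.1
      have h2 := h.tendsto_tailIntegral hH hα (hψs s) one_pos
      rw [← hα.tailIntegral_eq (hψs s) hs.1] at h1
      rw [← hα.tailIntegral_eq (hψs s) one_pos] at h2
      have h3 := h1.sub h2
      rw [← sub_div] at h3
      refine h3.congr' ?_
      filter_upwards [eventually_gt_atTop 0] with t ht
      rw [tailIntegral_map_smul ht (hψs s), tailIntegral_map_smul ht (hψs s), sub_div]
  refine hmain.congr' ?_
  filter_upwards [eventually_gt_atTop 0] with t ht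
  rw [(key t ht).2.2, integral_div]

/-- Asymptotics of truncated first moments of `H` in the tail. -/
theorem HasPowerLawTail.tendsto_integral_tail [IsProbabilityMeasure P]
    (h : HasPowerLawTail P H a μ) (hH : Measurable H) (hα : IsTailIndex μ α) (hα1 : 1 < α)
    {φ : E d → ℝ} (hφ : Continuous φ) :
    Tendsto (fun t => (∫ x in {x | 1 < ‖x‖}, ‖x‖ * φ (‖x‖⁻¹ • x)
        ∂((P.map H).map (fun x => t⁻¹ • x))) / (P.map H).real {x | t < ‖x‖}) atTop
      (𝓝 ((1 + 1 / (α - 1)) * (tailIntegral μ φ 1 / μ.real {x | 1 < ‖x‖}))) := by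
  have hprob : IsProbabilityMeasure (P.map H) := Measure.isProbabilityMeasure_map hH.aemeasurable
  set G : ℝ → ℝ := fun t => (P.map H).real {x | t < ‖x‖} with hG
  have hGpos : ∀ t, 0 < G t := h.tail_pos hH hα
  have hGanti : Antitone G := antitone_real_lt_norm _
  -- q < α is what the Potter bound needs, and q > 1 makes s^{-q} integrable at infinity.
  obtain ⟨q, hq1, hq2⟩ := exists_between hα1
  obtain ⟨C, t₀, hC, ht₀, hpot⟩ := exists_potter_upper hGanti hGpos
    (h.tendsto_tail_two hH hα) (one_pos.trans hq1) hq2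
  obtain ⟨K, hK0, hK⟩ := exists_bound_on_sphere hφ
  have hqint : IntegrableOn (fun s : ℝ => s ^ (-q)) (Set.Ioi 1) :=
    integrableOn_Ioi_rpow_of_lt (by linarith) one_pos
  have key : ∀ t : ℝ, t₀ ≤ t → _ := fun t ht =>
    integral_tail_eq (m := (P.map H).map (fun x => t⁻¹ • x)) hφ (by
      have ht0 := ht₀.trans_le ht
      refine (hqint.const_mul (C * G t)).mono' (antitone_real_lt_norm _).measurable.aestronglyMeasurable ?_
      rw [ae_restrict_iff' measurableSet_Ioi]
      refine Eventually.of_forall fun s hs => ?_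
      rw [Real.norm_of_nonneg measureReal_nonneg, map_smul_real_lt_norm ht0]
      exact (hpot t ht s (le_of_lt hs)).trans (le_of_eq (by ring)))
  -- For φ without a sign the tail integral is not monotone in s, so its measurability comes from
  -- integrating a jointly measurable function.
  have hanti : ∀ ρ : Measure (E d), IsFiniteMeasure ρ →
      AEStronglyMeasurable (fun s => tailIntegral ρ φ s) (volume.restrict (Set.Ioi (1 : ℝ))) := by
    intro ρ _
    have : Measurable ({p : ℝ × E d | p.1 < ‖p.2‖}.indicator fun p => φ (‖p.2‖⁻¹ • p.2)) :=
      (hφ.measurable.comp (measurable_direction.comp measurable_snd)).indicator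
        (measurableSet_lt measurable_fst measurable_snd.norm)
    refine (this.stronglyMeasurable.integral_prod_right' (ν := ρ)).aestronglyMeasurable.congr ?_
    refine Eventually.of_forall fun s => ?_
    exact (integral_indicator (measurableSet_lt_norm s) :
      ∫ x, {x : E d | s < ‖x‖}.indicator (fun x => φ (‖x‖⁻¹ • x)) x ∂ρ = _)
  have hmain : Tendsto (fun t => ∫ s in Set.Ioi (1 : ℝ),
      tailIntegral ((P.map H).map (fun x => t⁻¹ • x)) φ s / G t) atTop
      (𝓝 (∫ s in Set.Ioi (1 : ℝ), s ^ (-α) * (tailIntegral μ φ 1 / μ.real {x | 1 < ‖x‖}))) := by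
    refine tendsto_integral_filter_of_dominated_convergence (fun s => K * C * s ^ (-q))
      ?_ ?_ (hqint.const_mul _) ?_
    · refine Eventually.of_forall fun t => ?_
      exact (hanti _ inferInstance).mul_const (G t)⁻¹
    · filter_upwards [eventually_ge_atTop t₀] with t ht
      have ht0 := ht₀.trans_le ht
      rw [ae_restrict_iff' measurableSet_Ioi]
      refine Eventually.of_forall fun s hs => ?_
      replace hs : 1 < s := hs
      rw [tailIntegral_map_smul ht0 hφ, norm_div, Real.norm_of_nonneg (hGpos t).le,
        div_le_iff₀ (hGpos t), Real.norm_eq_abs]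
      calc _ ≤ K * G (t * s) := abs_tailIntegral_le (measure_lt_top _ _) (by positivity) hK
        _ ≤ K * (C * s ^ (-q) * G t) := by
            gcongr
            exact hpot t ht s hs.le
        _ = _ := by ring
    · rw [ae_restrict_iff' measurableSet_Ioi]
      refine Eventually.of_forall fun s hs => ?_
      replace hs : 1 < s := hs
      have h1 := h.tendsto_tailIntegral hH hα hφ (zero_lt_one.trans hs)
      rw [mul_div_assoc] at h1
      refine h1.congr' ?_
      filter_upwards [eventually_gt_atTop 0] with t ht
      rw [tailIntegral_map_smul ht hφ]
  rw [integral_mul_const, integral_Ioi_rpow_of_lt (by linarith) one_pos] at hmain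
  have h1 := h.tendsto_tailIntegral hH hα hφ one_pos
  have h2 := h1.add hmain
  -- The integral of s^{-α} over (1, ∞) is 1/(α-1); the additional 1 is the boundary term at level
  -- 1.
  have hval : 1 ^ (-α) * tailIntegral μ φ 1 / μ.real {x | 1 < ‖x‖} +
      -1 ^ (-α + 1) / (-α + 1) * (tailIntegral μ φ 1 / μ.real {x | 1 < ‖x‖}) =
      (1 + 1 / (α - 1)) * (tailIntegral μ φ 1 / μ.real {x | 1 < ‖x‖}) := by
    have h3 : α - 1 ≠ 0 := by linarith
    have h4 : -α + 1 ≠ 0 := by linarith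
    have h5 : -1 / (-α + 1) = 1 / (α - 1) := by
      rw [div_eq_div_iff h4 h3]
      ring
    rw [Real.one_rpow, Real.one_rpow, h5]
    ring
  rw [hval] at h2
  refine h2.congr' ?_
  filter_upwards [eventually_ge_atTop t₀] with t ht
  rw [key t ht, integral_div, add_div, tailIntegral_map_smul (ht₀.trans_le ht) hφ]

end Asymptotics

end TruncatedTails

namespace TruncatedTails

/-! ### The compensated exponential -/

section CompExp

variable {d : ℕ} {b : ℝ}

/-- The exponential `e^{⟨l,x⟩} - 1`, compensated by `b ⟨l,x⟩`. -/
noncomputable def compExp (b : ℝ) (l x : E d) : ℝ :=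
  Real.exp (inner ℝ l x) - 1 - b * inner ℝ l x

/-- The radial derivative of `compExp`. -/
noncomputable def compExpDensity (b : ℝ) (l : E d) (s : ℝ) (x : E d) : ℝ :=
  inner ℝ l x * (Real.exp (s * inner ℝ l x) - b)

/-- The order of compensation for the tail index `α`. -/
noncomputable def compOrder (α : ℝ) : ℝ := if α < 1 then 0 else 1

lemma compOrder_eq (α : ℝ) : compOrder α = 0 ∨ compOrder α = 1 := by
  unfold compOrder
  split_ifs <;> simp

lemma compOrder_nonneg (α : ℝ) : 0 ≤ compOrder α := by
  rcases compOrder_eq α with h | h <;> rw [h]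
  exact zero_le_one

lemma lt_one_add_compOrder {α : ℝ} (hα : α < 2) : α < 1 + compOrder α := by
  unfold compOrder
  split_ifs with h <;> linarith

lemma integrand_eq_compExp (α : ℝ) (l x : E d) : integrand α l x = compExp (compOrder α) l x := by
  unfold integrand compExp compOrder
  split_ifs <;> ring

lemma continuous_compExp (b : ℝ) (l : E d) : Continuous (compExp b l) := by
  unfold compExp
  fun_prop

lemma continuous_compExpDensity (b : ℝ) (l : E d) :
    Continuous (Function.uncurry (compExpDensity b l)) := by
  unfold compExpDensity Function.uncurry
  fun_prop

/-- Without compensation the exponential is merely bounded; with it, |e^u - 1| ≤ |u| e^R gains a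
factor s. The form s^b lets all later estimates treat both cases at once. -/
lemma abs_exp_sub_le (hb : b = 0 ∨ b = 1) {R s u : ℝ} (hR : 0 ≤ R) (hs : 0 ≤ s) (hs1 : s ≤ 1)
    (hu : |u| ≤ R * s) : |Real.exp u - b| ≤ (1 + R) * Real.exp R * s ^ b := by
  have hRs : R * s ≤ R := mul_le_of_le_one_right hR hs1
  have hexp : Real.exp u ≤ Real.exp R := Real.exp_le_exp.2 ((le_abs_self u).trans (hu.trans hRs))
  have hpos := Real.exp_pos R
  rcases hb with rfl | rfl
  · rw [sub_zero, Real.rpow_zero, mul_one, abs_of_pos (Real.exp_pos u)]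
    nlinarith
  · rw [Real.rpow_one]
    have h1 : u ≤ Real.exp u - 1 := by linarith [Real.add_one_le_exp u]
    have h2 : Real.exp u - 1 ≤ u * Real.exp u := by
      have := mul_le_mul_of_nonneg_right (Real.add_one_le_exp (-u)) (Real.exp_pos u).le
      rw [← Real.exp_add, neg_add_cancel, Real.exp_zero] at this
      linarith
    have h3 : |Real.exp u - 1| ≤ |u| * Real.exp R := by
      have hexp1 : 1 ≤ Real.exp R := Real.one_le_exp hR
      rw [abs_le]
      constructor
      · have := neg_abs_le u
        nlinarith [abs_nonneg u]
      · refine h2.trans ((mul_le_mul_of_nonneg_right (le_abs_self u) (Real.exp_pos u).le).trans ?_)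
        exact mul_le_mul_of_nonneg_left hexp (abs_nonneg u)
    calc |Real.exp u - 1| ≤ R * s * Real.exp R := h3.trans (by gcongr)
      _ ≤ (1 + R) * Real.exp R * s := by nlinarith [mul_nonneg hs hpos.le]

lemma abs_compExpDensity_le (hb : b = 0 ∨ b = 1) (l : E d) (s : ℝ) (hs : 0 < s) (hs1 : s ≤ 1)
    (x : E d) (hx : ‖x‖ = 1) :
    |compExpDensity b l s x| ≤ ‖l‖ * ((1 + ‖l‖) * Real.exp ‖l‖) * s ^ b := by
  have h1 : |(inner ℝ l x : ℝ)| ≤ ‖l‖ := by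
    simpa [hx] using abs_real_inner_le_norm l x
  have h2 : |s * inner ℝ l x| ≤ ‖l‖ * s := by
    rw [abs_mul, abs_of_pos hs, mul_comm]
    gcongr
  rw [compExpDensity, abs_mul, mul_assoc ‖l‖]
  exact mul_le_mul h1 (abs_exp_sub_le hb (norm_nonneg l) hs.le hs1 h2) (abs_nonneg _)
    (norm_nonneg l)

lemma norm_mul_inner_direction (l x : E d) :
    ‖x‖ * inner ℝ l (‖x‖⁻¹ • x) = inner ℝ l x := by
  by_cases hx : x = 0
  · simp [hx]
  · rw [real_inner_smul_right, mul_inv_cancel_left₀ (norm_ne_zero_iff.2 hx)]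

/-- The fundamental theorem of calculus along a ray puts the compensated exponential into the form
required by `integral_ball_eq`. -/
lemma integral_compExpDensity (b : ℝ) (l x : E d) :
    ∫ s in (0 : ℝ)..‖x‖, compExpDensity b l s (‖x‖⁻¹ • x) = compExp b l x := by
  set u : ℝ := inner ℝ l (‖x‖⁻¹ • x) with hu
  have hderiv : ∀ s : ℝ, HasDerivAt (fun s => Real.exp (s * u) - b * (s * u))
      (u * (Real.exp (s * u) - b)) s := by
    intro s
    have h1 : HasDerivAt (fun s : ℝ => s * u) u s := by
      simpa using (hasDerivAt_id s).mul_const u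
    exact (h1.exp.sub (h1.const_mul b)).congr_deriv (by ring)
  have := intervalIntegral.integral_eq_sub_of_hasDerivAt (a := 0) (b := ‖x‖)
    (fun s _ => hderiv s) (Continuous.intervalIntegrable (by fun_prop) _ _)
  simp only [compExpDensity]
  rw [this, hu, norm_mul_inner_direction]
  simp [compExp]
  ring

lemma integral_rpow_norm (hb : 0 ≤ b) (x : E d) :
    ∫ s in (0 : ℝ)..‖x‖, (1 + b) * s ^ b = ‖x‖ ^ (1 + b) := by
  rw [intervalIntegral.integral_const_mul, integral_rpow (Or.inl (by linarith)),
    Real.zero_rpow (by linarith), add_comm b 1]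
  field_simp
  ring

end CompExp

/-! ### Integrals with respect to the limit measures -/

section LimitMeasures

variable {Ω : Type*} [MeasurableSpace Ω] {P : Measure Ω} {d : ℕ} {H : Ω → E d} {a : ℕ → ℝ}
  {μ : Measure (E d)} {α : ℝ}

lemma compl_closedBall_eq : (Metric.closedBall (0 : E d) 1)ᶜ = {x | 1 < ‖x‖} := by
  ext x
  simp

/-- The unit sphere is μ-null: for r < 1 the closed tail at 1 has mass at most r^{-α} times that of
the open one, and r → 1. This reconciles the set ‖x‖ ≥ 1 in `spectral` with the complement of the
closed ball. -/
lemma HasPowerLawTail.setOf_le_ae_eq (h : HasPowerLawTail P H a μ) (hα : IsTailIndex μ α) :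
    {x : E d | 1 ≤ ‖x‖} =ᵐ[μ] {x | 1 < ‖x‖} := by
  have hsub : {x : E d | 1 < ‖x‖} ⊆ {x | 1 ≤ ‖x‖} := fun x (hx : 1 < ‖x‖) => hx.le
  have hfin : μ {x : E d | 1 ≤ ‖x‖} < ⊤ :=
    (measure_mono (fun x (hx : 1 ≤ ‖x‖) => lt_of_lt_of_le one_half_lt_one hx)).trans_lt
      (h.radon (1 / 2) (by norm_num))
  refine (ae_eq_of_subset_of_measure_ge hsub ?_ (measurableSet_lt_norm 1).nullMeasurableSet
    hfin.ne).symm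
  rw [← ENNReal.toReal_le_toReal hfin.ne (h.radon 1 one_pos).ne]
  have hcont : Tendsto (fun r : ℝ => r ^ (-α) * μ.real {x : E d | 1 < ‖x‖}) (𝓝[<] 1)
      (𝓝 (1 ^ (-α) * μ.real {x : E d | 1 < ‖x‖})) :=
    ((Real.continuousAt_rpow_const 1 (-α) (Or.inl one_ne_zero)).mul
      continuousAt_const).tendsto.mono_left nhdsWithin_le_nhds
  rw [Real.one_rpow, one_mul] at hcont
  refine ge_of_tendsto hcont ?_
  filter_upwards [self_mem_nhdsWithin, (lt_mem_nhds one_pos).filter_mono nhdsWithin_le_nhds]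
    with r hr hr0
  rw [← hα.real_lt_norm hr0]
  exact ENNReal.toReal_mono (h.radon r hr0).ne
    (measure_mono fun x (hx : 1 ≤ ‖x‖) => lt_of_lt_of_le hr hx)

lemma HasPowerLawTail.isFiniteMeasure_spectral (h : HasPowerLawTail P H a μ)
    (hα : IsTailIndex μ α) : IsFiniteMeasure (spectral μ) := by
  constructor
  have hfin : μ {x : E d | 1 ≤ ‖x‖} < ⊤ := by
    rw [measure_congr (h.setOf_le_ae_eq hα)]
    exact h.radon 1 one_pos
  have hpos := (ENNReal.toReal_pos_iff.1 (h.tail_one_pos hα)).1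
  rw [spectral, Measure.smul_apply, Measure.map_apply measurable_direction MeasurableSet.univ,
    compl_closedBall_eq, Set.preimage_univ, Measure.restrict_apply_univ, smul_eq_mul]
  exact ENNReal.mul_lt_top (ENNReal.inv_lt_top.2 hpos) hfin

lemma ae_spectral_mem_sphere (μ : Measure (E d)) : ∀ᵐ x ∂(spectral μ), ‖x‖ = 1 := by
  refine Measure.ae_smul_measure ?_ _
  rw [ae_map_iff measurable_direction.aemeasurable
    (measurableSet_eq_fun measurable_norm measurable_const),
    ae_restrict_iff' (measurableSet_le measurable_const measurable_norm)]
  exact Eventually.of_forall fun x (hx : 1 ≤ ‖x‖) =>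
    norm_direction_of_lt le_rfl (one_pos.trans_le hx)

lemma spectral_restrict_sphere (μ : Measure (E d)) :
    (spectral μ).restrict (Metric.sphere 0 1) = spectral μ :=
  Measure.restrict_eq_self_of_ae_mem
    ((ae_spectral_mem_sphere μ).mono fun x hx => by simpa using hx)

lemma HasPowerLawTail.integrable_spectral (h : HasPowerLawTail P H a μ) (hα : IsTailIndex μ α)
    {φ : E d → ℝ} (hφ : Continuous φ) : Integrable φ (spectral μ) := by
  have := h.isFiniteMeasure_spectral hα
  obtain ⟨K, -, hK⟩ := exists_bound_on_sphere hφ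
  exact Integrable.of_bound hφ.aestronglyMeasurable K ((ae_spectral_mem_sphere μ).mono hK)

lemma HasPowerLawTail.integral_spectral (h : HasPowerLawTail P H a μ) (hα : IsTailIndex μ α)
    {φ : E d → ℝ} (hφ : Continuous φ) :
    ∫ x, φ x ∂(spectral μ) = tailIntegral μ φ 1 / μ.real {x | 1 < ‖x‖} := by
  rw [spectral, integral_smul_measure, integral_map measurable_direction.aemeasurable
    hφ.aestronglyMeasurable, setIntegral_congr_set (h.setOf_le_ae_eq hα), compl_closedBall_eq,
    ENNReal.toReal_inv, smul_eq_mul, inv_mul_eq_div]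
  rfl

lemma HasPowerLawTail.integrable_nu (h : HasPowerLawTail P H a μ) (hα : IsTailIndex μ α)
    {f : E d → ℝ} (hf : Continuous f) (hball : IntegrableOn f (Metric.closedBall 0 1) μ) :
    Integrable f (nu μ) := by
  have hpos := (ENNReal.toReal_pos_iff.1 (h.tail_one_pos hα)).1
  rw [nu, spectral_restrict_sphere, compl_closedBall_eq]
  exact (Integrable.smul_measure hball (ENNReal.inv_lt_top.2 hpos).ne).add_measure
    (h.integrable_spectral hα hf)

lemma HasPowerLawTail.integral_nu (h : HasPowerLawTail P H a μ) (hα : IsTailIndex μ α)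
    {f : E d → ℝ} (hf : Continuous f) (hball : IntegrableOn f (Metric.closedBall 0 1) μ) :
    ∫ x, f x ∂(nu μ) = ((∫ x in Metric.closedBall 0 1, f x ∂μ) + tailIntegral μ f 1) /
      μ.real {x | 1 < ‖x‖} := by
  have hpos := (ENNReal.toReal_pos_iff.1 (h.tail_one_pos hα)).1
  rw [nu, spectral_restrict_sphere, integral_add_measure _ (h.integrable_spectral hα hf),
    h.integral_spectral hα hf, integral_smul_measure, compl_closedBall_eq, ENNReal.toReal_inv,
    smul_eq_mul, inv_mul_eq_div, add_div]
  · rfl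
  · rw [compl_closedBall_eq]
    exact Integrable.smul_measure hball (ENNReal.inv_lt_top.2 hpos).ne

lemma ae_nu_norm_le (μ : Measure (E d)) : ∀ᵐ x ∂(nu μ), ‖x‖ ≤ 1 := by
  rw [nu, spectral_restrict_sphere, ae_add_measure_iff]
  constructor
  · refine Measure.ae_smul_measure ?_ _
    rw [ae_restrict_iff' Metric.isClosed_closedBall.measurableSet]
    exact Eventually.of_forall fun x hx => by simpa using hx
  · exact (ae_spectral_mem_sphere μ).mono fun x hx => hx.le

lemma HasPowerLawTail.integrableOn_ball_of_density (h : HasPowerLawTail P H a μ)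
    (hα : IsTailIndex μ α) {b K : ℝ} (hαb : α < 1 + b) {ψ : ℝ → E d → ℝ}
    (hψ : Continuous (Function.uncurry ψ))
    (hK : ∀ s, 0 < s → s ≤ 1 → ∀ x, ‖x‖ = 1 → |ψ s x| ≤ K * s ^ b) :
    IntegrableOn (fun x => ∫ s in (0 : ℝ)..‖x‖, ψ s (‖x‖⁻¹ • x)) (Metric.closedBall 0 1) μ := by
  have : SigmaFinite μ := sigmaFinite_of_tail_lt_top h.radon h.not_charge_zero
  exact (integral_ball_eq h.radon hψ hK (hα.integrableOn_rpow_mul hαb)).1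

lemma HasPowerLawTail.integrableOn_compExp (h : HasPowerLawTail P H a μ)
    (hα : IsTailIndex μ α) (hα2 : α < 2) (l : E d) :
    IntegrableOn (compExp (compOrder α) l) (Metric.closedBall 0 1) μ := by
  have := h.integrableOn_ball_of_density hα (lt_one_add_compOrder hα2)
    (continuous_compExpDensity (compOrder α) l) (abs_compExpDensity_le (compOrder_eq α) l)
  simpa only [integral_compExpDensity] using this

/-- Provides the dominating function for differentiating `Lam` under the integral sign. -/
lemma HasPowerLawTail.integrable_nu_rpow (h : HasPowerLawTail P H a μ)
    (hα : IsTailIndex μ α) (hα2 : α < 2) :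
    Integrable (fun x => ‖x‖ ^ (1 + compOrder α)) (nu μ) := by
  have hb := compOrder_nonneg α
  refine h.integrable_nu hα
    ((Real.continuous_rpow_const (by linarith)).comp continuous_norm) ?_
  have hψ : Continuous (Function.uncurry
      (fun (s : ℝ) (_ : E d) => (1 + compOrder α) * s ^ compOrder α)) :=
    continuous_const.mul ((Real.continuous_rpow_const hb).comp continuous_fst)
  have := h.integrableOn_ball_of_density hα (K := 1 + compOrder α) (lt_one_add_compOrder hα2) hψ
    (fun s hs _ _ _ => by
      rw [abs_of_nonneg (mul_nonneg (by linarith) (Real.rpow_nonneg hs.le _))])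
  simpa only [integral_rpow_norm hb] using this

/-- Separates the linear part on the sphere from the exponential part, so that the terms match the
limits found for the ball, the tail and the drift. The coefficient 1 + 1/(α-1) for α > 1 joins the
compensator inside the integrand to the explicit drift of Λ. -/
lemma HasPowerLawTail.Lam_eq (h : HasPowerLawTail P H a μ) (hα : IsTailIndex μ α) (hα2 : α < 2)
    (l : E d) : Lam μ α l = ((∫ x in Metric.closedBall 0 1, compExp (compOrder α) l x ∂μ) +
      tailIntegral μ (fun x => Real.exp (inner ℝ l x) - 1) 1) / μ.real {x | 1 < ‖x‖} -
      (compOrder α + if α ≤ 1 then 0 else 1 / (α - 1)) *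
        (tailIntegral μ (fun x => inner ℝ l x) 1 / μ.real {x | 1 < ‖x‖}) := by
  have h1 : ∫ x, integrand α l x ∂(nu μ) = ((∫ x in Metric.closedBall 0 1,
      compExp (compOrder α) l x ∂μ) + tailIntegral μ (compExp (compOrder α) l) 1) /
      μ.real {x | 1 < ‖x‖} := by
    simp only [integrand_eq_compExp]
    exact h.integral_nu hα (continuous_compExp _ _) (h.integrableOn_compExp hα hα2 l)
  have h2 : tailIntegral μ (compExp (compOrder α) l) 1 =
      tailIntegral μ (fun x => Real.exp (inner ℝ l x) - 1) 1 -
        compOrder α * tailIntegral μ (fun x => inner ℝ l x) 1 := by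
    have := tailIntegral_sub (m := μ) (φ := fun x : E d => Real.exp (inner ℝ l x) - 1)
      (ψ := fun x : E d => compOrder α * inner ℝ l x) (h.radon 1 one_pos) (by fun_prop)
      (by fun_prop) zero_le_one
    refine this.trans (congrArg _ ?_)
    exact integral_const_mul _ _
  have h3 := h.integral_spectral hα (φ := fun x => inner ℝ l x) (by fun_prop)
  rw [Lam, h1, h2, h3]
  split_ifs <;> ring

/-- The gradient of the integrand in l is (e^{⟨l,x⟩} - b) x. On the unit ball, which carries ν, it
is bounded by a multiple of ‖x‖^{1+b}, locally uniformly in l. -/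
lemma HasPowerLawTail.differentiable_Lam (h : HasPowerLawTail P H a μ) (hα : IsTailIndex μ α)
    (hα2 : α < 2) : Differentiable ℝ (Lam μ α) := by
  have h1 : Differentiable ℝ (fun l => ∫ x, integrand α l x ∂(nu μ)) := by
    intro l₀
    set R := ‖l₀‖ + 1 with hR
    have hR0 : 0 ≤ R := by positivity
    set b := compOrder α with hb
    set F' : E d → E d → (E d →L[ℝ] ℝ) := fun l x =>
      (Real.exp (inner ℝ l x) - b) • innerSL ℝ x with hF'
    refine (hasFDerivAt_integral_of_dominated_of_fderiv_le (F := integrand α) (F' := F')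
      (bound := fun x => (1 + R) * Real.exp R * ‖x‖ ^ (1 + b))
      (Metric.ball_mem_nhds l₀ one_pos) ?_ ?_ ?_ ?_ ?_ ?_).differentiableAt
    · refine Eventually.of_forall fun l => ?_
      exact ((continuous_compExp b l).congr
        fun x => (integrand_eq_compExp α l x).symm).aestronglyMeasurable
    · exact (h.integrable_nu hα (continuous_compExp b l₀)
        (h.integrableOn_compExp hα hα2 l₀)).congr
        (Eventually.of_forall fun x => (integrand_eq_compExp α l₀ x).symm)
    · refine Continuous.aestronglyMeasurable ?_
      simp only [hF']
      have : Continuous (fun x : E d => innerSL ℝ x) := (innerSL ℝ).continuous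
      fun_prop
    · refine (ae_nu_norm_le μ).mono fun x hx l hl => ?_
      have hl' : ‖l‖ ≤ R := by
        have h1 : ‖l - l₀‖ < 1 := by simpa [dist_eq_norm] using hl
        have h2 := norm_sub_norm_le l l₀
        linarith
      have hinner : |(inner ℝ l x : ℝ)| ≤ R * ‖x‖ :=
        (abs_real_inner_le_norm l x).trans (by gcongr)
      have hexp := abs_exp_sub_le (compOrder_eq α) hR0 (norm_nonneg x) hx hinner
      simp only [hF']
      rw [norm_smul, innerSL_apply_norm, Real.norm_eq_abs]
      by_cases hx0 : x = 0
      · have : 1 + b ≠ 0 := by have := compOrder_nonneg α; linarith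
        simp [hx0, Real.zero_rpow this]
      · rw [add_comm 1 b, Real.rpow_add_one (norm_ne_zero_iff.2 hx0), ← mul_assoc]
        gcongr
    · exact (h.integrable_nu_rpow hα hα2).const_mul _
    · refine Eventually.of_forall fun x l _ => ?_
      have hin : HasFDerivAt (fun l : E d => (inner ℝ l x : ℝ)) (innerSL ℝ x) l := by
        have := (innerSL ℝ x).hasFDerivAt (x := l)
        refine this.congr_of_eventuallyEq (Eventually.of_forall fun y => ?_)
        simp [real_inner_comm]
      have := (hin.exp.sub_const 1).sub (hin.const_mul b)
      refine (this.congr_of_eventuallyEq (Eventually.of_forall fun l =>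
        integrand_eq_compExp α l x)).congr_fderiv ?_
      simp only [hF', sub_smul]
  have h2 : Differentiable ℝ (fun l : E d => ∫ s, inner ℝ l s ∂(spectral μ)) := by
    have := h.isFiniteMeasure_spectral hα
    have hid : Integrable (fun s : E d => s) (spectral μ) :=
      Integrable.of_bound continuous_id.aestronglyMeasurable 1
        ((ae_spectral_mem_sphere μ).mono fun x hx => hx.le)
    have hswap : ∀ l : E d, ∫ s, inner ℝ l s ∂(spectral μ) = inner ℝ l (∫ s, s ∂(spectral μ)) :=
      integral_inner hid
    simp only [hswap]
    exact fun l => differentiableAt_id.inner ℝ (differentiableAt_const _)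
  unfold Lam
  split_ifs
  · exact h1
  · exact h1.sub (h2.const_mul _)

end LimitMeasures

end TruncatedTails

namespace TruncatedTails

/-! ### The exponential moments of a truncated vector -/

section Moments

variable {Ω : Type*} [MeasurableSpace Ω] {P : Measure Ω} {d : ℕ} {H : Ω → E d} {a : ℕ → ℝ}
  {μ : Measure (E d)} {α : ℝ}

lemma abs_exp_sub_one_le_exp_abs_sub_one (x : ℝ) :
    |Real.exp x - 1| ≤ Real.exp |x| - 1 := by
  rw [abs_le]
  constructor
  · have h1 := Real.add_one_le_exp x
    have h2 := Real.add_one_le_exp |x|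
    have h3 := neg_abs_le x
    linarith
  · linarith [Real.exp_le_exp.2 (le_abs_self x)]

/-- Decomposition of the exponential of a truncated vector according to the truncation. -/
lemma exp_inner_truncate (b : ℝ) (l h : E d) {t : ℝ} (ht : 0 < t) (ℓ : ℝ) :
    Real.exp (t⁻¹ * inner ℝ l (truncate t h ℓ)) = 1 +
      (Metric.closedBall (0 : E d) 1).indicator (compExp b l) (t⁻¹ • h) +
      b * (Metric.closedBall (0 : E d) 1).indicator (fun x => inner ℝ l x) (t⁻¹ • h) +
      {x : E d | 1 < ‖x‖}.indicator (fun x => Real.exp (inner ℝ l (‖x‖⁻¹ • x)) - 1) (t⁻¹ • h) +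
      {x : E d | t < ‖x‖}.indicator (fun x => Real.exp (inner ℝ l (‖x‖⁻¹ • x)) *
        (Real.exp (inner ℝ l (‖x‖⁻¹ • x) * (t⁻¹ * ℓ)) - 1)) h := by
  have hnorm : ‖t⁻¹ • h‖ = t⁻¹ * ‖h‖ := by
    rw [norm_smul, norm_inv, Real.norm_of_nonneg ht.le]
  by_cases hle : ‖h‖ ≤ t
  · have h1 : ‖t⁻¹ • h‖ ≤ 1 := by
      rw [hnorm, inv_mul_le_iff₀ ht, mul_one]
      exact hle
    have h2 : t⁻¹ • h ∈ Metric.closedBall (0 : E d) 1 := by simpa using h1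
    have h3 : t⁻¹ • h ∉ {x : E d | 1 < ‖x‖} := not_lt.2 h1
    have h4 : h ∉ {x : E d | t < ‖x‖} := not_lt.2 hle
    rw [Set.indicator_of_mem h2, Set.indicator_of_mem h2, Set.indicator_of_notMem h3,
      Set.indicator_of_notMem h4, truncate, if_pos hle, compExp, real_inner_smul_right]
    ring
  · have h1 : 1 < ‖t⁻¹ • h‖ := by
      rw [hnorm, lt_inv_mul_iff₀ ht, mul_one]
      exact not_le.1 hle
    have h2 : t⁻¹ • h ∉ Metric.closedBall (0 : E d) 1 := by simpa using h1
    have h3 : t⁻¹ • h ∈ {x : E d | 1 < ‖x‖} := h1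
    have h4 : h ∈ {x : E d | t < ‖x‖} := not_le.1 hle
    rw [Set.indicator_of_notMem h2, Set.indicator_of_notMem h2, Set.indicator_of_mem h3,
      Set.indicator_of_mem h4, truncate, if_neg hle, direction_smul (inv_pos.2 ht),
      real_inner_smul_right]
    set v : ℝ := inner ℝ l (‖h‖⁻¹ • h)
    have : t⁻¹ * ((t + ℓ) * v) = v + v * (t⁻¹ * ℓ) := by
      field_simp
    rw [this, Real.exp_add]
    ring

lemma measurable_truncate {X : Type*} [MeasurableSpace X] {f : X → E d} {g : X → ℝ}
    (hf : Measurable f) (hg : Measurable g) (t : ℝ) :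
    Measurable (fun x => truncate t (f x) (g x)) := by
  unfold truncate
  exact Measurable.ite (measurableSet_le hf.norm measurable_const) hf
    ((hg.const_add t).smul (hf.norm.inv.smul hf))

lemma integral_indicator_scaled (hH : Measurable H) (t : ℝ) {S : Set (E d)} (hS : MeasurableSet S)
    {g : E d → ℝ} (hg : Measurable g) :
    ∫ ω, S.indicator g (t⁻¹ • H ω) ∂P = ∫ x in S, g x ∂((P.map H).map (fun x => t⁻¹ • x)) := by
  have hm : Measurable (fun x : E d => t⁻¹ • x) := measurable_const_smul _
  rw [← integral_indicator hS, integral_map hm.aemeasurable (hg.indicator hS).aestronglyMeasurable]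
  exact (integral_map (f := fun x => S.indicator g (t⁻¹ • x)) hH.aemeasurable
    ((hg.indicator hS).comp hm).aestronglyMeasurable).symm

lemma integral_odd_eq_zero (hsymm : IdentDistrib H (fun ω => -H ω) P P) {f : E d → ℝ}
    (hf : Measurable f) (hodd : ∀ x, f (-x) = -f x) : ∫ ω, f (H ω) ∂P = 0 := by
  have h1 := (hsymm.comp hf).integral_eq
  simp only [Function.comp_def, hodd, integral_neg] at h1
  linarith

lemma measurable_inner_left (l : E d) : Measurable (fun x : E d => (inner ℝ l x : ℝ)) := by
  fun_prop

/-- The drift produced by the compensation on the unit ball. -/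
theorem HasPowerLawTail.tendsto_drift [IsProbabilityMeasure P] (h : HasPowerLawTail P H a μ)
    (hH : Measurable H) (hα : IsTailIndex μ α)
    (hsymm : α = 1 → IdentDistrib H (fun ω => -H ω) P P)
    (hmean : 1 < α → Integrable H P ∧ ∫ ω, H ω ∂P = 0) (l : E d) :
    Tendsto (fun t => compOrder α * ((∫ x in Metric.closedBall 0 1, inner ℝ l x
        ∂((P.map H).map (fun x => t⁻¹ • x))) / (P.map H).real {x | t < ‖x‖})) atTop
      (𝓝 (-((compOrder α + if α ≤ 1 then 0 else 1 / (α - 1)) *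
        (tailIntegral μ (fun x => inner ℝ l x) 1 / μ.real {x | 1 < ‖x‖})))) := by
  rcases lt_trichotomy α 1 with hlt | heq | hgt
  · have : compOrder α = 0 := if_pos hlt
    simp [this, hlt.le]
  -- Symmetry makes the tail integrals of an odd function vanish at every level, hence in the limit
  -- too.
  · have hI : tailIntegral μ (fun x => inner ℝ l x) 1 / μ.real {x | 1 < ‖x‖} = 0 := by
      have h1 := h.tendsto_tailIntegral hH hα (φ := fun x => inner ℝ l x) (by fun_prop) one_pos
      rw [← hα.tailIntegral_eq (by fun_prop) one_pos] at h1
      refine tendsto_nhds_unique h1 (tendsto_const_nhds.congr fun t => ?_)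
      have hm : Measurable ({x : E d | t * 1 < ‖x‖}.indicator
          (fun x => (inner ℝ l (‖x‖⁻¹ • x) : ℝ))) :=
        ((measurable_inner_left l).comp measurable_direction).indicator (measurableSet_lt_norm _)
      rw [tailIntegral, ← integral_indicator (measurableSet_lt_norm _), integral_map hH.aemeasurable
        hm.aestronglyMeasurable, integral_odd_eq_zero (hsymm heq) hm, zero_div]
      intro x
      simp only [Set.indicator, Set.mem_ofPred_eq, norm_neg, smul_neg, inner_neg_right]
      split_ifs <;> simp
    rw [hI, mul_zero, neg_zero]
    refine tendsto_const_nhds.congr fun t => ?_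
    rw [← integral_indicator_scaled hH t Metric.isClosed_closedBall.measurableSet
      (measurable_inner_left l), integral_odd_eq_zero (hsymm heq)
      (f := fun x => (Metric.closedBall (0 : E d) 1).indicator (fun x => inner ℝ l x) (t⁻¹ • x))
      (((measurable_inner_left l).indicator Metric.isClosed_closedBall.measurableSet).comp
        (measurable_const_smul _)), zero_div, mul_zero]
    intro x
    simp only [Set.indicator, mem_closedBall_zero_iff, norm_neg, smul_neg, inner_neg_right]
    split_ifs <;> simp
  · have hb : compOrder α = 1 := if_neg (by linarith)
    obtain ⟨hHint, hH0⟩ := hmean hgt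
    have h1 := h.tendsto_integral_tail hH hα hgt (φ := fun x => inner ℝ l x) (by fun_prop)
    simp only [norm_mul_inner_direction] at h1
    rw [hb, if_neg (not_le.2 hgt)]
    refine h1.neg.congr fun t => ?_
    -- Centring: the first moment over the ball is minus the one over the tail, whose asymptotics
    -- are known.
    have hsum : (∫ x in Metric.closedBall 0 1, inner ℝ l x
        ∂((P.map H).map (fun x => t⁻¹ • x))) + ∫ x in {x | 1 < ‖x‖}, inner ℝ l x
        ∂((P.map H).map (fun x => t⁻¹ • x)) = 0 := by
      have hm : Measurable (fun x : E d => t⁻¹ • x) := measurable_const_smul _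
      have hint : Integrable (fun x => (inner ℝ l x : ℝ))
          ((P.map H).map (fun x => t⁻¹ • x)) := by
        rw [Measure.map_map hm hH, integrable_map_measure
          (measurable_inner_left l).aestronglyMeasurable (hm.comp hH).aemeasurable]
        exact (hHint.smul t⁻¹).const_inner l
      rw [← compl_closedBall_eq, integral_add_compl Metric.isClosed_closedBall.measurableSet hint,
        Measure.map_map hm hH, integral_map (hm.comp hH).aemeasurable
          (measurable_inner_left l).aestronglyMeasurable]
      have := integral_inner (𝕜 := ℝ) (hHint.smul t⁻¹) l
      simp only [Pi.smul_apply, integral_smul, hH0, smul_zero, inner_zero_right] at this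
      exact this
    rw [one_mul, ← neg_div, eq_neg_of_add_eq_zero_left hsum]

lemma integrable_exp_mul_of_le [IsFiniteMeasure P] {L : Ω → ℝ} (hL : Measurable L)
    (hL0 : ∀ᵐ ω ∂P, 0 ≤ L ω) {ε κ : ℝ} (hε : Integrable (fun ω => Real.exp (ε * L ω)) P)
    (hκ : κ ≤ ε) : Integrable (fun ω => Real.exp (κ * L ω)) P := by
  refine hε.mono' (by fun_prop) (hL0.mono fun ω hω => ?_)
  rw [Real.norm_of_nonneg (Real.exp_pos _).le]
  gcongr

lemma tendsto_mul_inv_atTop (κ : ℝ) : Tendsto (fun t : ℝ => κ * t⁻¹) atTop (𝓝 0) := by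
  simpa using tendsto_inv_atTop_zero.const_mul κ

lemma tendsto_integral_exp_mul_inv [IsProbabilityMeasure P] {L : Ω → ℝ} (hL : Measurable L)
    (hL0 : ∀ᵐ ω ∂P, 0 ≤ L ω) {ε : ℝ} (hε0 : 0 < ε)
    (hε : Integrable (fun ω => Real.exp (ε * L ω)) P) (κ : ℝ) :
    Tendsto (fun t : ℝ => ∫ ω, Real.exp (κ * t⁻¹ * L ω) ∂P) atTop (𝓝 1) := by
  have h1 : ∫ _ω, (1 : ℝ) ∂P = 1 := by simp
  rw [← h1]
  refine tendsto_integral_filter_of_dominated_convergence (fun ω => Real.exp (ε * L ω)) ?_ ?_ hε ?_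
  · exact Eventually.of_forall fun t => by fun_prop
  · filter_upwards [(tendsto_mul_inv_atTop κ).eventually_lt_const hε0] with t ht
    refine hL0.mono fun ω hω => ?_
    rw [Real.norm_of_nonneg (Real.exp_pos _).le]
    gcongr
  · refine Eventually.of_forall fun ω => ?_
    have := (Real.continuous_exp.tendsto 0).comp
      (by simpa using (tendsto_mul_inv_atTop κ).mul_const (L ω) :
        Tendsto (fun t : ℝ => κ * t⁻¹ * L ω) atTop (𝓝 0))
    simpa [Function.comp_def] using this

/-- The contribution of the overshoot beyond the truncation level. -/
noncomputable def overshoot (l : E d) (t : ℝ) (h : E d) (ℓ : ℝ) : ℝ :=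
  {x : E d | t < ‖x‖}.indicator (fun x => Real.exp (inner ℝ l (‖x‖⁻¹ • x)) *
    (Real.exp (inner ℝ l (‖x‖⁻¹ • x) * (t⁻¹ * ℓ)) - 1)) h

lemma measurable_overshoot (l : E d) (t : ℝ) :
    Measurable (fun p : E d × ℝ => overshoot l t p.1 p.2) := by
  have h1 : Measurable (fun p : E d × ℝ => Real.exp (inner ℝ l (‖p.1‖⁻¹ • p.1)) *
      (Real.exp (inner ℝ l (‖p.1‖⁻¹ • p.1) * (t⁻¹ * p.2)) - 1)) := by
    fun_prop
  exact h1.indicator (s := {p : E d × ℝ | t < ‖p.1‖})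
    (measurableSet_lt measurable_const measurable_fst.norm)

/-- The bound is a product of a function of h and a function of ℓ, so that independence can be used.
-/
lemma abs_overshoot_le (l h : E d) {t : ℝ} (ht : 0 < t) {ℓ : ℝ} (hℓ : 0 ≤ ℓ) :
    |overshoot l t h ℓ| ≤ Real.exp ‖l‖ *
      ({x : E d | t < ‖x‖}.indicator (fun _ => 1) h * (Real.exp (‖l‖ * t⁻¹ * ℓ) - 1)) := by
  by_cases hh : h ∈ {x : E d | t < ‖x‖}
  · rw [overshoot, Set.indicator_of_mem hh, Set.indicator_of_mem hh, one_mul]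
    set v : ℝ := inner ℝ l (‖h‖⁻¹ • h)
    have hv : |v| ≤ ‖l‖ := by
      have := abs_real_inner_le_norm l (‖h‖⁻¹ • h)
      rwa [norm_direction_of_lt ht.le hh, mul_one] at this
    have hw : 0 ≤ t⁻¹ * ℓ := by positivity
    rw [abs_mul, abs_of_pos (Real.exp_pos _)]
    refine mul_le_mul (Real.exp_le_exp.2 ((le_abs_self v).trans hv)) ?_ (abs_nonneg _)
      (Real.exp_pos _).le
    refine (abs_exp_sub_one_le_exp_abs_sub_one _).trans ?_
    rw [abs_mul, abs_of_nonneg hw, mul_assoc ‖l‖]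
    gcongr
  · rw [overshoot, Set.indicator_of_notMem hh, Set.indicator_of_notMem hh]
    simp

section Overshoot

variable [IsProbabilityMeasure P] {L : Ω → ℝ} {ε : ℝ}

lemma integrable_indicator_mul_exp_sub_one (hH : Measurable H) (hL : Measurable L)
    (hL0 : ∀ᵐ ω ∂P, 0 ≤ L ω) (hε : Integrable (fun ω => Real.exp (ε * L ω)) P)
    (hindep : IndepFun H L P) {κ t : ℝ} (hκ : κ ≤ ε) :
    Integrable (fun ω => {x : E d | t < ‖x‖}.indicator (fun _ => (1 : ℝ)) (H ω) *
      (Real.exp (κ * L ω) - 1)) P ∧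
    ∫ ω, {x : E d | t < ‖x‖}.indicator (fun _ => (1 : ℝ)) (H ω) * (Real.exp (κ * L ω) - 1) ∂P =
      (P.map H).real {x | t < ‖x‖} * ((∫ ω, Real.exp (κ * L ω) ∂P) - 1) := by
  have hind : Measurable ({x : E d | t < ‖x‖}.indicator (fun _ => (1 : ℝ))) :=
    measurable_const.indicator (measurableSet_lt_norm t)
  have hexp : Measurable (fun x : ℝ => Real.exp (κ * x) - 1) := by fun_prop
  have hI := integrable_exp_mul_of_le hL hL0 hε hκ
  have hind' := hindep.comp hind hexp
  have hX : Integrable ({x : E d | t < ‖x‖}.indicator (fun _ => (1 : ℝ)) ∘ H) P := by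
    refine Integrable.of_bound (hind.comp hH).aestronglyMeasurable 1 (Eventually.of_forall fun ω => ?_)
    simp only [Function.comp_apply, Set.indicator]
    split_ifs <;> simp
  refine ⟨hind'.integrable_mul hX (hI.sub (integrable_const 1)), ?_⟩
  have := hind'.integral_fun_mul_eq_mul_integral hX.aestronglyMeasurable
    (hI.sub (integrable_const 1)).aestronglyMeasurable
  refine this.trans ?_
  congr 1
  · refine (integral_map hH.aemeasurable hind.aestronglyMeasurable).symm.trans ?_
    rw [integral_indicator_const _ (measurableSet_lt_norm t), smul_eq_mul, mul_one]
  · simp only [Function.comp_apply]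
    rw [integral_sub hI (integrable_const 1)]
    simp

lemma integrable_overshoot (hH : Measurable H) (hL : Measurable L)
    (hL0 : ∀ᵐ ω ∂P, 0 ≤ L ω) (hε : Integrable (fun ω => Real.exp (ε * L ω)) P)
    (hindep : IndepFun H L P) (l : E d) {t : ℝ} (ht : 0 < t) (htε : ‖l‖ * t⁻¹ ≤ ε) :
    Integrable (fun ω => overshoot l t (H ω) (L ω)) P := by
  refine ((integrable_indicator_mul_exp_sub_one hH hL hL0 hε hindep (t := t) htε).1.const_mul
    (Real.exp ‖l‖)).mono' ((measurable_overshoot l t).comp (hH.prodMk hL)).aestronglyMeasurable ?_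
  exact hL0.mono fun ω hω => abs_overshoot_le l (H ω) ht hω

/-- Independence extracts the tail probability from the bound of `abs_overshoot_le`. After division
there remains a multiple of E e^{‖l‖L/t} - 1, which tends to 0; this is why the law of L does not
enter Λ. -/
lemma tendsto_overshoot (hH : Measurable H) (hL : Measurable L)
    (hL0 : ∀ᵐ ω ∂P, 0 ≤ L ω) (hε0 : 0 < ε) (hε : Integrable (fun ω => Real.exp (ε * L ω)) P)
    (hindep : IndepFun H L P) (hpos : ∀ t, 0 < (P.map H).real {x | t < ‖x‖}) (l : E d) :
    Tendsto (fun t => (∫ ω, overshoot l t (H ω) (L ω) ∂P) / (P.map H).real {x | t < ‖x‖})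
      atTop (𝓝 0) := by
  have hlim : Tendsto (fun t : ℝ => Real.exp ‖l‖ *
      ((∫ ω, Real.exp (‖l‖ * t⁻¹ * L ω) ∂P) - 1)) atTop (𝓝 0) := by
    simpa using ((tendsto_integral_exp_mul_inv hL hL0 hε0 hε ‖l‖).sub_const 1).const_mul
      (Real.exp ‖l‖)
  refine squeeze_zero_norm' ?_ hlim
  filter_upwards [eventually_gt_atTop 0,
    (tendsto_mul_inv_atTop ‖l‖).eventually_lt_const hε0] with t ht htε
  obtain ⟨h1, h2⟩ := integrable_indicator_mul_exp_sub_one hH hL hL0 hε hindep (t := t) htε.le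
  rw [norm_div, Real.norm_of_nonneg (hpos t).le, div_le_iff₀ (hpos t)]
  calc _ ≤ ∫ ω, Real.exp ‖l‖ * ({x : E d | t < ‖x‖}.indicator (fun _ => (1 : ℝ)) (H ω) *
        (Real.exp (‖l‖ * t⁻¹ * L ω) - 1)) ∂P :=
        norm_integral_le_of_norm_le (h1.const_mul _)
          (hL0.mono fun ω hω => abs_overshoot_le l (H ω) ht hω)
    _ = _ := by
        rw [integral_const_mul, h2]
        ring

end Overshoot

/-- The exponential moments of a truncated vector exist at large levels. -/
lemma integrable_exp_truncate [IsProbabilityMeasure P] {L : Ω → ℝ} {ε : ℝ} (hH : Measurable H)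
    (hL : Measurable L) (hL0 : ∀ᵐ ω ∂P, 0 ≤ L ω)
    (hε : Integrable (fun ω => Real.exp (ε * L ω)) P)
    (l : E d) {t : ℝ} (ht : 0 < t) (htε : ‖l‖ * t⁻¹ ≤ ε) :
    Integrable (fun ω => Real.exp (t⁻¹ * inner ℝ l (truncate t (H ω) (L ω)))) P := by
  refine ((integrable_exp_mul_of_le hL hL0 hε htε).const_mul (Real.exp ‖l‖)).mono' ?_ ?_
  · exact (((measurable_inner_left l).comp (measurable_truncate hH hL t)).const_mul
      t⁻¹).exp.aestronglyMeasurable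
  · refine hL0.mono fun ω hω => ?_
    rw [Real.norm_of_nonneg (Real.exp_pos _).le, ← Real.exp_add, Real.exp_le_exp]
    have hnorm : ‖truncate t (H ω) (L ω)‖ ≤ t + L ω := by
      unfold truncate
      split_ifs with hle
      · linarith
      · rw [norm_smul, norm_direction_of_lt ht.le (not_le.1 hle), mul_one,
          Real.norm_of_nonneg (by linarith)]
    calc t⁻¹ * inner ℝ l (truncate t (H ω) (L ω)) ≤ t⁻¹ * (‖l‖ * (t + L ω)) := by
          gcongr
          exact (real_inner_le_norm _ _).trans (by gcongr)
      _ = ‖l‖ + ‖l‖ * t⁻¹ * L ω := by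
          field_simp

/-- The scaled exponential moments of a truncated vector converge to `Λ`. -/
theorem HasPowerLawTail.tendsto_integral_exp_truncate [IsProbabilityMeasure P]
    (h : HasPowerLawTail P H a μ) (hH : Measurable H) (hα : IsTailIndex μ α) (hα2 : α < 2)
    (hsymm : α = 1 → IdentDistrib H (fun ω => -H ω) P P)
    (hmean : 1 < α → Integrable H P ∧ ∫ ω, H ω ∂P = 0) {L : Ω → ℝ} (hL : Measurable L)
    (hL0 : ∀ᵐ ω ∂P, 0 ≤ L ω) {ε : ℝ} (hε0 : 0 < ε)
    (hε : Integrable (fun ω => Real.exp (ε * L ω)) P) {H₀ : Ω → E d} (hH₀ : Measurable H₀)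
    (hid : P.map H₀ = P.map H) (hindep : IndepFun H₀ L P) (l : E d) :
    Tendsto (fun t => ((∫ ω, Real.exp (t⁻¹ * inner ℝ l (truncate t (H₀ ω) (L ω))) ∂P) - 1) /
      (P.map H).real {x | t < ‖x‖}) atTop (𝓝 (Lam μ α l)) := by
  have hA := h.tendsto_integral_ball hH hα (compOrder_nonneg α) (lt_one_add_compOrder hα2)
    (continuous_compExpDensity (compOrder α) l) (abs_compExpDensity_le (compOrder_eq α) l)
  simp only [integral_compExpDensity] at hA
  have hB := h.tendsto_drift hH hα hsymm hmean l
  have hC := h.tendsto_tailIntegral hH hα (φ := fun x => Real.exp (inner ℝ l x) - 1)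
    (by fun_prop) one_pos
  rw [← hα.tailIntegral_eq (by fun_prop) one_pos] at hC
  -- Independence of L is known for the copy `H₀`, the tail hypotheses concern `H`; only their
  -- common law matters.
  have hR := tendsto_overshoot hH₀ hL hL0 hε0 hε hindep
    (by rw [hid]; exact h.tail_pos hH hα) l
  rw [hid] at hR
  have hsum := ((hA.add hB).add hC).add hR
  have hval : (∫ x in Metric.closedBall 0 1, compExp (compOrder α) l x ∂μ) /
      μ.real {x | 1 < ‖x‖} + -((compOrder α + if α ≤ 1 then 0 else 1 / (α - 1)) *
        (tailIntegral μ (fun x => inner ℝ l x) 1 / μ.real {x | 1 < ‖x‖})) +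
      tailIntegral μ (fun x => Real.exp (inner ℝ l x) - 1) 1 / μ.real {x | 1 < ‖x‖} + 0 =
      Lam μ α l := by
    rw [h.Lam_eq hα hα2 l]
    ring
  rw [hval] at hsum
  refine hsum.congr' ?_
  filter_upwards [eventually_gt_atTop 0,
    (tendsto_mul_inv_atTop ‖l‖).eventually_lt_const hε0] with t ht htε
  have hball : MeasurableSet (Metric.closedBall (0 : E d) 1) :=
    Metric.isClosed_closedBall.measurableSet
  have hscale : Measurable (fun ω => t⁻¹ • H₀ ω) :=
    (measurable_const_smul t⁻¹).comp hH₀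
  have hbdd : ∀ {g : E d → ℝ}, Continuous g →
      Integrable (fun ω => (Metric.closedBall (0 : E d) 1).indicator g (t⁻¹ • H₀ ω)) P := by
    intro g hg
    obtain ⟨K, hK⟩ := (isCompact_closedBall (0 : E d) 1).exists_bound_of_continuousOn
      hg.continuousOn
    have hK0 : 0 ≤ K := (norm_nonneg _).trans (hK 0 (by simp))
    refine Integrable.of_bound ((hg.measurable.indicator hball).comp hscale).aestronglyMeasurable K
      (Eventually.of_forall fun ω => ?_)
    by_cases hω : t⁻¹ • H₀ ω ∈ Metric.closedBall (0 : E d) 1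
    · rw [Set.indicator_of_mem hω]
      exact hK _ hω
    · rw [Set.indicator_of_notMem hω, norm_zero]
      exact hK0
  have hcont : Continuous (fun x : E d => Real.exp (inner ℝ l x) - 1) := by fun_prop
  have hIC : Integrable (fun ω => {x : E d | 1 < ‖x‖}.indicator
      (fun x => Real.exp (inner ℝ l (‖x‖⁻¹ • x)) - 1) (t⁻¹ • H₀ ω)) P := by
    obtain ⟨K, hK0, hK⟩ := exists_bound_on_sphere hcont
    refine Integrable.of_bound (((hcont.measurable.comp measurable_direction).indicator
      (measurableSet_lt_norm 1)).comp hscale).aestronglyMeasurable K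
      (Eventually.of_forall fun ω => ?_)
    by_cases hω : t⁻¹ • H₀ ω ∈ {x : E d | 1 < ‖x‖}
    · rw [Set.indicator_of_mem hω]
      exact hK _ (norm_direction_of_lt zero_le_one hω)
    · rw [Set.indicator_of_notMem hω, norm_zero]
      exact hK0
  have hIA := hbdd (continuous_compExp (compOrder α) l)
  have hIB := (hbdd (g := fun x => inner ℝ l x) (by fun_prop)).const_mul (compOrder α)
  have hIR := integrable_overshoot hH₀ hL hL0 hε hindep l ht htε.le
  have hI1 : Integrable (fun _ : Ω => (1 : ℝ)) P := integrable_const 1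
  have hexp : ∫ ω, Real.exp (t⁻¹ * inner ℝ l (truncate t (H₀ ω) (L ω))) ∂P = 1 +
      (∫ x in Metric.closedBall 0 1, compExp (compOrder α) l x
        ∂((P.map H).map (fun x => t⁻¹ • x))) +
      compOrder α * (∫ x in Metric.closedBall 0 1, inner ℝ l x
        ∂((P.map H).map (fun x => t⁻¹ • x))) +
      tailIntegral (P.map H) (fun x => Real.exp (inner ℝ l x) - 1) (t * 1) +
      ∫ ω, overshoot l t (H₀ ω) (L ω) ∂P := by
    have hdec : (fun ω => Real.exp (t⁻¹ * inner ℝ l (truncate t (H₀ ω) (L ω)))) = fun ω => _ :=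
      funext fun ω => exp_inner_truncate (compOrder α) l (H₀ ω) ht (L ω)
    rw [hdec]
    have hdir : Measurable (fun x : E d => Real.exp (inner ℝ l (‖x‖⁻¹ • x)) - 1) :=
      hcont.measurable.comp measurable_direction
    have e1 := integral_add (((hI1.add hIA).add hIB).add hIC) hIR
    have e2 := integral_add ((hI1.add hIA).add hIB) hIC
    have e3 := integral_add (hI1.add hIA) hIB
    have e4 := integral_add hI1 hIA
    simp only [Pi.add_apply] at e1 e2 e3 e4
    refine e1.trans ?_
    rw [e2, e3, e4, integral_const_mul,
      integral_indicator_scaled hH₀ t hball (continuous_compExp _ _).measurable,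
      integral_indicator_scaled hH₀ t hball (measurable_inner_left l),
      integral_indicator_scaled hH₀ t (measurableSet_lt_norm 1) hdir, hid,
      ← tailIntegral_map_smul ht hcont]
    simp [tailIntegral]
  rw [hexp]
  ring

end Moments

/-! ### Independence of the summands -/

section Independence

variable {Ω : Type*} [MeasurableSpace Ω] {P : Measure Ω}

/-- Two independent sequences of independent variables form a sequence of independent pairs. -/
lemma iIndepFun_pair {β γ : Type*} [MeasurableSpace β] [MeasurableSpace γ] {X : ℕ → Ω → β}
    {Y : ℕ → Ω → γ} (hX : ∀ j, Measurable (X j)) (hY : ∀ j, Measurable (Y j))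
    (hXi : iIndepFun X P) (hYi : iIndepFun Y P)
    (hXY : IndepFun (fun ω j => X j ω) (fun ω j => Y j ω) P) :
    iIndepFun (fun j ω => (X j ω, Y j ω)) P := by
  have hXYj : ∀ j, IndepFun (X j) (Y j) P := fun j =>
    hXY.comp (measurable_pi_apply j) (measurable_pi_apply j)
  rw [iIndepFun_iff_iIndep]
  -- Measurable rectangles form a π-system generating the σ-algebra of each pair, and on them the
  -- probability factors, first between the two sequences and then within each.
  set π : ℕ → Set (Set Ω) := fun j => {s | ∃ A B, MeasurableSet A ∧ MeasurableSet B ∧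
    X j ⁻¹' A ∩ Y j ⁻¹' B = s} with hπ
  refine iIndepSets.iIndep (fun j => ((hX j).prodMk (hY j)).comap_le) π ?_ ?_ ?_
  · rintro j _ ⟨A, B, hA, hB, rfl⟩ _ ⟨A', B', hA', hB', rfl⟩ -
    refine ⟨A ∩ A', B ∩ B', hA.inter hA', hB.inter hB', ?_⟩
    rw [Set.preimage_inter, Set.preimage_inter]
    exact Set.inter_inter_inter_comm _ _ _ _
  · intro j
    rw [← generateFrom_prod, MeasurableSpace.comap_generateFrom]
    congr 1
    ext s
    constructor
    · rintro ⟨_, ⟨A, hA, B, hB, rfl⟩, rfl⟩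
      exact ⟨A, B, hA, hB, rfl⟩
    · rintro ⟨A, B, hA, hB, rfl⟩
      exact ⟨A ×ˢ B, ⟨A, hA, B, hB, rfl⟩, rfl⟩
  · rw [iIndepSets_iff]
    intro S f hf
    choose! A B hA hB hAB using hf
    have h1 : ⋂ i ∈ S, f i = (⋂ i ∈ S, X i ⁻¹' A i) ∩ ⋂ i ∈ S, Y i ⁻¹' B i := by
      rw [Set.iInter₂_congr fun i hi => (hAB i hi).symm]
      simp only [Set.iInter_inter_distrib]
    have h2 : P ((⋂ i ∈ S, X i ⁻¹' A i) ∩ ⋂ i ∈ S, Y i ⁻¹' B i) =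
        P (⋂ i ∈ S, X i ⁻¹' A i) * P (⋂ i ∈ S, Y i ⁻¹' B i) := by
      have := indepFun_iff_measure_inter_preimage_eq_mul.1 hXY
        (⋂ i ∈ S, (fun x => x i) ⁻¹' A i) (⋂ i ∈ S, (fun x => x i) ⁻¹' B i)
        (MeasurableSet.biInter S.countable_toSet fun i hi => measurable_pi_apply i (hA i hi))
        (MeasurableSet.biInter S.countable_toSet fun i hi => measurable_pi_apply i (hB i hi))
      simpa only [Set.preimage_iInter, ← Set.preimage_comp, Function.comp_def] using this
    rw [h1, h2, iIndepFun_iff_measure_inter_preimage_eq_mul.1 hXi S hA,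
      iIndepFun_iff_measure_inter_preimage_eq_mul.1 hYi S hB, ← Finset.prod_mul_distrib]
    refine Finset.prod_congr rfl fun i hi => ?_
    rw [← hAB i hi, indepFun_iff_measure_inter_preimage_eq_mul.1 (hXYj i) _ _ (hA i hi) (hB i hi)]

end Independence

/-- Logarithms of quantities close to one, relative to a null sequence. -/
lemma tendsto_log_div {W G : ℕ → ℝ} {c : ℝ} (hG : Tendsto G atTop (𝓝 0)) (hG0 : ∀ n, 0 < G n)
    (hW : Tendsto (fun n => (W n - 1) / G n) atTop (𝓝 c)) :
    Tendsto (fun n => Real.log (W n) / G n) atTop (𝓝 c) := by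
  have hW1 : Tendsto W atTop (𝓝 1) := by
    have := (hW.mul hG).add_const 1
    rw [mul_zero, zero_add] at this
    refine this.congr fun n => ?_
    rw [div_mul_cancel₀ _ (hG0 n).ne', sub_add_cancel]
  -- Squeeze by 1 - 1/W ≤ log W ≤ W - 1.
  have hlow := hW.div hW1 one_ne_zero
  rw [div_one] at hlow
  refine tendsto_of_tendsto_of_tendsto_of_le_of_le' hlow hW ?_ ?_
  · filter_upwards [hW1.eventually_const_lt zero_lt_one] with n hn
    calc (W n - 1) / G n / W n = (1 - (W n)⁻¹) / G n := by
          field_simp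
      _ ≤ _ := div_le_div_of_nonneg_right (Real.one_sub_inv_le_log_of_pos hn) (hG0 n).le
  · filter_upwards [hW1.eventually_const_lt zero_lt_one] with n hn
    exact div_le_div_of_nonneg_right (Real.log_le_sub_one_of_pos hn) (hG0 n).le

/-- The products n P(‖H‖ > a_n) converge, so the tail vanishes along a_n, and monotonicity extends
this to all levels. -/
lemma HasPowerLawTail.tendsto_tail_zero {Ω : Type*} [MeasurableSpace Ω] {P : Measure Ω} {d : ℕ}
    {H : Ω → E d} {a : ℕ → ℝ} {μ : Measure (E d)} {α : ℝ} [IsProbabilityMeasure P]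
    (h : HasPowerLawTail P H a μ) (hH : Measurable H) (hα : IsTailIndex μ α) :
    Tendsto (fun t => (P.map H).real {x | t < ‖x‖}) atTop (𝓝 0) := by
  have hprob : IsProbabilityMeasure (P.map H) := Measure.isProbabilityMeasure_map hH.aemeasurable
  have h1 := h.tendsto_tailIntegral_seq hH hα (φ := fun _ => 1) continuous_const
    (fun _ => zero_le_one) one_pos
  have h2 : Tendsto (fun n => (P.map H).real {x | a n < ‖x‖}) atTop (𝓝 0) := by
    have := h1.mul tendsto_inv_atTop_nhds_zero_nat
    rw [mul_zero] at this
    refine this.congr' ?_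
    filter_upwards [eventually_gt_atTop 0] with n hn
    have : (n : ℝ) ≠ 0 := by positivity
    rw [tailIntegral_one, mul_one]
    field_simp
  refine tendsto_order.2 ⟨fun b hb => Eventually.of_forall fun t => hb.trans_le measureReal_nonneg,
    fun b hb => ?_⟩
  obtain ⟨n, hn⟩ := (h2.eventually_lt_const hb).exists
  filter_upwards [eventually_ge_atTop (a n)] with t ht
  exact (antitone_real_lt_norm _ ht).trans_lt hn

end TruncatedTails

/-! ### Assembly: row sums and the large deviation principle -/

namespace TruncatedTails

/-- The scaled cumulant generating functions of the normalized row sums converge to `Λ`. -/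
theorem scaledCGFTendsto_rowSum {Ω : Type*} [MeasurableSpace Ω] {P : Measure Ω}
    [IsProbabilityMeasure P] {d : ℕ} {H : Ω → E d} (hH : Measurable H) {a : ℕ → ℝ}
    {μ : Measure (E d)} {α : ℝ} (htail : HasPowerLawTail P H a μ) (hindex : IsTailIndex μ α)
    (hα : α < 2) (hsymm : α = 1 → IdentDistrib H (fun ω => -H ω) P P)
    (hmean : 1 < α → Integrable H P ∧ ∫ ω, H ω ∂P = 0) {L : Ω → ℝ}
    (hLnonneg : ∀ᵐ ω ∂P, 0 ≤ L ω)
    (hLexp : ∃ ε : ℝ, 0 < ε ∧ Integrable (fun ω => Real.exp (ε * L ω)) P) {Hs : ℕ → Ω → E d}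
    (hHs : ∀ j, Measurable (Hs j)) (hHsindep : iIndepFun Hs P)
    (hHsid : ∀ j, IdentDistrib (Hs j) H P P) {Ls : ℕ → Ω → ℝ} (hLs : ∀ j, Measurable (Ls j))
    (hLsindep : iIndepFun Ls P) (hLsid : ∀ j, IdentDistrib (Ls j) L P P)
    (hindep : IndepFun (fun ω j => Hs j ω) (fun ω j => Ls j ω) P) {M : ℕ → ℝ}
    (hM : Tendsto M atTop atTop)
    (hhard : Tendsto (fun n : ℕ => (n : ℝ) * P.real {ω | M n < ‖H ω‖}) atTop atTop) :
    ScaledCGFTendsto P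
      (fun n ω => ((n : ℝ) * M n * P.real {ω' | M n < ‖H ω'‖})⁻¹ • rowSum M Hs Ls n ω)
      (fun n : ℕ => (n : ℝ) * P.real {ω | M n < ‖H ω‖}) (Lam μ α) := by
  obtain ⟨ε, hε0, hε⟩ := hLexp
  have hL0 : ∀ᵐ ω ∂P, 0 ≤ Ls 0 ω :=
    (hLsid 0).symm.ae_snd (p := fun x => 0 ≤ x) measurableSet_Ici hLnonneg
  have hε' : Integrable (fun ω => Real.exp (ε * Ls 0 ω)) P :=
    ((hLsid 0).comp (u := fun x => Real.exp (ε * x)) (by fun_prop)).integrable_iff.2 hε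
  have hG : ∀ t, P.real {ω | t < ‖H ω‖} = (P.map H).real {x | t < ‖x‖} := fun t =>
    (map_measureReal_apply hH (measurableSet_lt_norm t)).symm
  have hGpos : ∀ t, 0 < P.real {ω | t < ‖H ω‖} := fun t => by
    rw [hG]
    exact htail.tail_pos hH hindex t
  have hpair : ∀ j, IndepFun (Hs j) (Ls j) P := fun j =>
    hindep.comp (measurable_pi_apply j) (measurable_pi_apply j)
  have hYid : ∀ (l : E d) (t : ℝ) (j : ℕ),
      IdentDistrib (fun ω => (inner ℝ l (truncate t (Hs j ω) (Ls j ω)) : ℝ))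
        (fun ω => (inner ℝ l (truncate t (Hs 0 ω) (Ls 0 ω)) : ℝ)) P P := fun l t j =>
    (((hHsid j).trans (hHsid 0).symm).prodMk ((hLsid j).trans (hLsid 0).symm) (hpair j)
      (hpair 0)).comp (u := fun p : E d × ℝ => (inner ℝ l (truncate t p.1 p.2) : ℝ))
      ((measurable_inner_left l).comp (measurable_truncate measurable_fst measurable_snd t))
  have hYmeas : ∀ (l : E d) (t : ℝ) (j : ℕ),
      Measurable (fun ω => (inner ℝ l (truncate t (Hs j ω) (Ls j ω)) : ℝ)) := fun l t j =>
    (measurable_inner_left l).comp (measurable_truncate (hHs j) (hLs j) t)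
  have hYindep : ∀ (l : E d) (t : ℝ),
      iIndepFun (fun j ω => (inner ℝ l (truncate t (Hs j ω) (Ls j ω)) : ℝ)) P := fun l t =>
    (iIndepFun_pair hHs hLs hHsindep hLsindep hindep).comp
      (fun _ p => (inner ℝ l (truncate t p.1 p.2) : ℝ)) fun _ =>
      (measurable_inner_left l).comp (measurable_truncate measurable_fst measurable_snd t)
  -- The speed cancels the normalisation except for 1/M_n, that is, c_n Z_n = S_n / M_n. At n = 0
  -- the cancellation would divide by zero, hence 0 < n.
  have hscale : ∀ (l : E d) (n : ℕ), 0 < n → ∀ ω,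
      (n : ℝ) * P.real {ω | M n < ‖H ω‖} *
        inner ℝ l (((n : ℝ) * M n * P.real {ω' | M n < ‖H ω'‖})⁻¹ • rowSum M Hs Ls n ω) =
      (M n)⁻¹ * (∑ j ∈ Finset.range n,
        fun ω => (inner ℝ l (truncate (M n) (Hs j ω) (Ls j ω)) : ℝ)) ω := by
    intro l n hn ω
    have hn' : (n : ℝ) ≠ 0 := by positivity
    have hg := (hGpos (M n)).ne'
    rw [real_inner_smul_right, rowSum, inner_sum, Finset.sum_apply, ← mul_assoc]
    congr 1
    field_simp
  have hI0 : ∀ l : E d, ∀ᶠ n in atTop,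
      Integrable (fun ω => Real.exp ((M n)⁻¹ * inner ℝ l (truncate (M n) (Hs 0 ω) (Ls 0 ω)))) P := by
    intro l
    filter_upwards [hM.eventually_gt_atTop 0,
      ((tendsto_mul_inv_atTop ‖l‖).comp hM).eventually_lt_const hε0] with n hn hnε
    exact integrable_exp_truncate (hHs 0) (hLs 0) hL0 hε' l hn hnε.le
  refine ⟨fun n => ?_, hhard, fun l => ?_, fun l => ?_⟩
  · have hsum : Measurable (rowSum M Hs Ls n) :=
      Finset.measurable_fun_sum _ fun j _ => measurable_truncate (hHs j) (hLs j) _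
    exact (measurable_const_smul ((n : ℝ) * M n * P.real {ω' | M n < ‖H ω'‖})⁻¹).comp hsum
  · filter_upwards [hI0 l, eventually_gt_atTop 0] with n hI hn
    simp only [hscale l n hn]
    refine (hYindep l (M n)).integrable_exp_mul_sum (hYmeas l (M n)) fun j _ => ?_
    exact ((hYid l (M n) j).comp (u := fun x => Real.exp ((M n)⁻¹ * x))
      (by fun_prop)).integrable_iff.2 hI
  · have hmap : P.map (Hs 0) = P.map H := (hHsid 0).map_eq
    have hlim := (htail.tendsto_integral_exp_truncate hH hindex hα hsymm hmean (hLs 0) hL0 hε0 hε'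
      (hHs 0) hmap (hpair 0) l).comp hM
    have hlog := tendsto_log_div ((htail.tendsto_tail_zero hH hindex).comp hM)
      (fun n => htail.tail_pos hH hindex (M n)) hlim
    refine hlog.congr' ?_
    filter_upwards [eventually_gt_atTop 0] with n hn
    simp only [hscale l n hn]
    -- The generating function of the sum is an n-th power, and the n from its logarithm cancels the
    -- n in the speed.
    have hprod := (hYindep l (M n)).mgf_sum (t := (M n)⁻¹) (hYmeas l (M n)) (Finset.range n)
    have hsame : ∀ j ∈ Finset.range n,
        mgf (fun ω => (inner ℝ l (truncate (M n) (Hs j ω) (Ls j ω)) : ℝ)) P (M n)⁻¹ =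
        mgf (fun ω => (inner ℝ l (truncate (M n) (Hs 0 ω) (Ls 0 ω)) : ℝ)) P (M n)⁻¹ := fun j _ =>
      ((hYid l (M n) j).comp (u := fun x => Real.exp ((M n)⁻¹ * x)) (by fun_prop)).integral_eq
    rw [Finset.prod_congr rfl hsame, Finset.prod_const, Finset.card_range] at hprod
    have hn' : (n : ℝ) ≠ 0 := by positivity
    have hg := htail.tail_pos hH hindex (M n)
    simp only [mgf] at hprod
    rw [hprod, Real.log_pow, hG, Function.comp_apply]
    field_simp

end TruncatedTails

theorem theorem3p1 {Ω : Type*} [MeasurableSpace Ω] (P : Measure Ω) [IsProbabilityMeasure P]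
    {d : ℕ}
    -- the generic heavy-tailed vector `H`, with its limit measure and its tail index
    (H : Ω → TruncatedTails.E d) (hH : Measurable H)
    (a : ℕ → ℝ) (μ : Measure (TruncatedTails.E d)) (α : ℝ)
    (htail : TruncatedTails.HasPowerLawTail P H a μ)
    (hindex : TruncatedTails.IsTailIndex μ α) (hα : α < 2)
    (hsymm : α = 1 → IdentDistrib H (fun ω => -H ω) P P)
    (hmean : 1 < α → Integrable H P ∧ ∫ ω, H ω ∂P = 0)
    -- the generic nonnegative variable `L`, with an exponential moment
    (L : Ω → ℝ) (hL : Measurable L) (hLnonneg : ∀ᵐ ω ∂P, 0 ≤ L ω)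
    (hLexp : ∃ ε : ℝ, 0 < ε ∧ Integrable (fun ω => Real.exp (ε * L ω)) P)
    -- the i.i.d. copies of `H` and of `L`, the two families being independent
    (Hs : ℕ → Ω → TruncatedTails.E d) (hHs : ∀ j, Measurable (Hs j))
    (hHsindep : iIndepFun Hs P) (hHsid : ∀ j, IdentDistrib (Hs j) H P P)
    (Ls : ℕ → Ω → ℝ) (hLs : ∀ j, Measurable (Ls j))
    (hLsindep : iIndepFun Ls P) (hLsid : ∀ j, IdentDistrib (Ls j) L P P)
    (hindep : IndepFun (fun ω j => Hs j ω) (fun ω j => Ls j ω) P)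
    -- the truncation levels, in the hard truncation regime
    (M : ℕ → ℝ) (hM : Tendsto M atTop atTop)
    (hhard : Tendsto (fun n : ℕ => (n : ℝ) * P.real {ω | M n < ‖H ω‖}) atTop atTop) :
    -- the integrals in the definition of `Λ` converge absolutely
    (∀ l : TruncatedTails.E d,
      Integrable (TruncatedTails.integrand α l) (TruncatedTails.nu μ) ∧
      Integrable (fun s => (inner ℝ l s : ℝ)) (TruncatedTails.spectral μ)) ∧
    TruncatedTails.IsLDP P
      (fun n ω => ((n : ℝ) * M n * P.real {ω' | M n < ‖H ω'‖})⁻¹ •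
        TruncatedTails.rowSum M Hs Ls n ω)
      (fun n : ℕ => (n : ℝ) * P.real {ω | M n < ‖H ω‖})
      (TruncatedTails.fenchelLegendre (TruncatedTails.Lam μ α)) := by
  refine ⟨fun l => ⟨?_, htail.integrable_spectral hindex (by fun_prop)⟩, ?_⟩
  · exact (htail.integrable_nu hindex (TruncatedTails.continuous_compExp _ l)
      (htail.integrableOn_compExp hindex hα l)).congr
      (Eventually.of_forall fun x => (TruncatedTails.integrand_eq_compExp α l x).symm)
  · exact TruncatedTails.isLDP_of_scaledCGFTendsto
      (TruncatedTails.scaledCGFTendsto_rowSum hH htail hindex hα hsymm hmean hLnonneg hLexp hHs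
        hHsindep hHsid hLs hLsindep hLsid hindep hM hhard)
      fun l => (htail.differentiable_Lam hindex hα l).hasGradientAt
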